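/- **Setting.** For $l=1,2$ let $\mathbb R^{m_l}$ carry a norm $\|\cdot\|$ with dual norm $\|y\|_*=\sup_{\|x\|\le1}\langle y,x\rangle$, let $X_l\subset\mathbb R^{m_l}$ be nonempty, compact and convex, and let $O_l\supseteq X_l$ be open. Network $\Sigma_l$ has agents $\mathcal V_l=\{1,\dots,n_l\}$, $n_l\ge1$. Let $(\Omega,\mathcal F,\mathbb P)$ be a probability space, $\xi:\Omega\to\mathbb R^d$ a random vector, and let agent $i\in\mathcal V_l$ have the cost $f_{l,i}(x_1,x_2)=\mathbb E[\Psi_{l,i}(x_1,x_2;\xi)]$, defined (with $\Psi_{l,i}(x_1,x_2;\xi)$ integrable) for $(x_1,x_2)\in O_1\times O_2$. On $X_1\times X_2$ each $f_{1,i}$ is convex in $x_1$ and concave in $x_2$, each $f_{2,j}$ is concave in $x_1$ and convex in $x_2$, and $$U:=\frac1{n_1}\sum_{i=1}^{n_1}f_{1,i}=-\frac1{n_2}\sum_{j=1}^{n_2}f_{2,j}.$$ The symbol $\partial_l$ denotes the subdifferential with respect to $x_l\in O_l$. *Communication.* Let $0<\eta<1$ and $B_l\ge 1$ be an integer. $\mathcal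 G_l(t)=(\mathcal V_l,\mathcal E_l(t))$, $t\ge0$, are digraphs with $(i,i)\in\mathcal E_l(t)$ for all $i$, such that $(\mathcal V_l,\bigcup_{t=k}^{k+B_l-1}\mathcal E_l(t))$ is strongly connected for every $k\ge0$. The matrices $W_l(t)=[w_{l,ij}(t)]$ have all row and column sums $1$, with $w_{l,ij}(t)\ge\eta$ if $(j,i)\in\mathcal E_l(t)$ and $w_{l,ij}(t)=0$ otherwise. Between the networks there are weights $w_{12,ij}(t)\ge0$ ($i\in\mathcal V_l$, $j\in\mathcal V_{3-l}$), positive only if $(j,i)$ is an edge of a digraph $\mathcal G_{12}(t)$ on $\mathcal V_1\cup\mathcal V_2$, with $\sum_{j}w_{12,ij}(t)=1$ for every $i$. Put $\Gamma_l=(1-\eta/(4n_l^2))^{-2}$ and $\theta_l=(1-\eta/(4n_l^2))^{1/B_l}$. *Algorithm (D-SMD).* Let $\psi_l$ be differentiable and $1$-strongly convex on $X_l$, $D_{\psi_l}(x,p)=\psi_l(x)-\psi_l(p)-\langle\nabla\psi_l(p),x-p\rangle$, and $P^l_x(y)=\arg\min_{x'\in X_l}\{\langle y,x-x'\rangle+D_{\psi_l}(x',x)\}$.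 Let $\{\alpha(t)\}_{t\ge0}$ be nonnegative and non-increasing. From deterministic $x_{l,i}(0)\in X_l$, for $t\ge0$, $l=1,2$ and $i\in\mathcal V_l$, $$v_{l,i}(t)=\sum_{j=1}^{n_l}w_{l,ij}(t)x_{l,j}(t),\qquad u_{3-l,i}(t)=\sum_{j=1}^{n_{3-l}}w_{12,ij}(t)x_{3-l,j}(t),\qquad x_{l,i}(t+1)=P^l_{v_{l,i}(t)}(-\alpha(t)\hat g_{l,i}(t)),$$ where $\hat g_{l,i}(t)$ is a sampled subgradient in $\partial_l\Psi_{l,i}(\cdot,\cdot;\xi_{l,i}(t))$ at the point with $l$-th coordinate $v_{l,i}(t)$ and other coordinate $u_{3-l,i}(t)$, and the $\xi_{l,i}(t)$ are i.i.d. copies of $\xi$. Let $\mathcal F_t=\sigma\{x_{l,i}(0),\xi_{l,i}(s): l=1,2,\ i\in\mathcal V_l,\ 0\le s\le t-1\}$; $\hat g_{l,i}(t)$ is $\mathcal F_{t+1}$-measurable. Let $g_{1,i}(t)\in\partial_1f_{1,i}(v_{1,i}(t),u_{2,i}(t))$ and $g_{2,i}(t)\in\partial_2f_{2,i}(u_{1,i}(t),v_{2,i}(t))$.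 Put $\Lambda_l=\max_{i\in\mathcal V_l}\|x_{l,i}(0)\|$. *Assumptions.* (A1) There is $L>0$ with $|f_{l,i}(x_1,x_2)-f_{l,i}(x_1',x_2')|\le L(\|x_1-x_1'\|+\|x_2-x_2'\|)$ on $O_1\times O_2$ for all $l,i$. (A2) There are $\nu_l>0$ with $\mathbb E[\hat g_{l,i}(t)\mid\mathcal F_t]=g_{l,i}(t)$ and $\mathbb E[\|g_{l,i}(t)-\hat g_{l,i}(t)\|_*^2\mid\mathcal F_t]\le\nu_l^2$ for all $l,i,t$. (A3) $D_{\psi_l}(x,y)$ is convex in $y\in X_l$, and $D_{\psi_l}(x_k,x)\to0$ whenever $x_k\to x$ in $X_l$. **Theorem.** Assume that $R_1^2:=\max\{D_{\psi_1}(x_1,x_1'):x_1,x_1'\in X_1\}$ exists. Then for every agent $i\in\mathcal V_1$ and every $T$ with $\alpha(T)>0$, the pseudo regret $$\bar R_1^{(i)}(T)=\mathbb E\Big[\sum_{t=1}^TU(x_{1,i}(t),u_{2,i}(t))\Big]-\min_{x_1\in X_1}\mathbb E\Big[\sum_{t=1}^TU(x_1,u_{2,i}(t))\Big]$$ satisfies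 $$\begin{aligned}\bar R_1^{(i)}(T)\le{}&\sum_{t=1}^T\sum_{l=1}^2(L+\nu_l)(9L+\nu_l)\alpha(t-1)+4L\sum_{t=1}^T\sum_{l=1}^2n_l\Gamma_l(L+\nu_l)\sum_{s=1}^{t-1}\theta_l^{t-1-s}\alpha(s-1)\\&+4L\sum_{t=1}^T\sum_{l=1}^2n_l\Gamma_l\theta_l^{t-1}\Lambda_l+\frac{R_1^2}{\alpha(T)}.\end{aligned}$$ -/

import Mathlib

open MeasureTheory ProbabilityTheory Filter Topology

noncomputable section

/-! The two networks are indexed by `l : Fin 2`; the index `0` is the first network and `1` the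
second one. A strategy profile is `z : ∀ l, E l`. -/

/-- The Bregman divergence of `ψ` on `X`. For `x, p ∈ X` with `X` convex and `ψ` differentiable
on `X`, the value of any derivative within `X` at `p` in the direction `x - p` is the same. -/
def bregman {E : Type*} [NormedAddCommGroup E] [NormedSpace ℝ E]
    (X : Set E) (ψ : E → ℝ) (x p : E) : ℝ :=
  ψ x - ψ p - fderivWithin ℝ ψ X p (x - p)

/-- `z` is a value of the prox-mapping: a minimizer over `x' ∈ X` of `⟨y, x - x'⟩ + D(x', x)`. -/
def IsProx {E : Type*} [NormedAddCommGroup E] [NormedSpace ℝ E]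
    (X : Set E) (ψ : E → ℝ) (x : E) (y : StrongDual ℝ E) (z : E) : Prop :=
  z ∈ X ∧ IsMinOn (fun x' => y (x - x') + bregman X ψ x' x) X z

/-- A differentiable regularizer on `X`, `1`-strongly convex for the norm of `E`. -/
structure IsRegularizer {E : Type*} [NormedAddCommGroup E] [NormedSpace ℝ E]
    (X : Set E) (ψ : E → ℝ) : Prop where
  differentiableOn : DifferentiableOn ℝ ψ X
  strongConvexOn : StrongConvexOn X 1 ψ

/-- The partial subdifferential at `z`, with respect to the coordinate `l`, of a function `h`
defined on the product of the sets `O k`. -/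
def partialSubdiff {E : Fin 2 → Type*} [∀ l, NormedAddCommGroup (E l)]
    [∀ l, NormedSpace ℝ (E l)] (O : ∀ l, Set (E l)) (l : Fin 2)
    (h : (∀ k, E k) → ℝ) (z : ∀ k, E k) : Set (StrongDual ℝ (E l)) :=
  {g | ∀ y ∈ O l, h z + g (y - z l) ≤ h (Function.update z l y)}

/-- The expected cost `E[Ψ(z; ξ)]`. -/
def expectedCost {E : Fin 2 → Type*} {Ω : Type*} [MeasurableSpace Ω] (P : Measure Ω) {d : ℕ}
    (ξ : Ω → Fin d → ℝ) (Ψ : (∀ k, E k) → (Fin d → ℝ) → ℝ) (z : ∀ k, E k) : ℝ :=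
  ∫ ω, Ψ z (ξ ω) ∂P

/-- The cost function of the game, the average of the costs in the first network. -/
def gameCost {E : Fin 2 → Type*} {n : Fin 2 → ℕ}
    (f : ∀ l, Fin (n l) → (∀ k, E k) → ℝ) (z : ∀ k, E k) : ℝ :=
  (1 / (n 0 : ℝ)) * ∑ i, f 0 i z

/-- A two-network zero-sum game with agent costs `f l i`. The strategy sets `X l` are compact and
convex, and the costs are defined on the product of open sets `O l ⊇ X l`. -/
structure IsTwoNetworkGame {E : Fin 2 → Type*} [∀ l, NormedAddCommGroup (E l)]
    [∀ l, NormedSpace ℝ (E l)] {n : Fin 2 → ℕ} (X O : ∀ l, Set (E l))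
    (f : ∀ l, Fin (n l) → (∀ k, E k) → ℝ) : Prop where
  compact : ∀ l, IsCompact (X l)
  convex : ∀ l, Convex ℝ (X l)
  isOpen : ∀ l, IsOpen (O l)
  subset : ∀ l, X l ⊆ O l
  /-- each cost is convex in the strategy of the agent's own network -/
  convexOn : ∀ l i, ∀ z : ∀ k, E k, (∀ k, z k ∈ X k) →
    ConvexOn ℝ (X l) (fun y => f l i (Function.update z l y))
  /-- and concave in the strategy of the other one -/
  concaveOn : ∀ l i, ∀ z : ∀ k, E k, (∀ k, z k ∈ X k) → ∀ k, k ≠ l →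
    ConcaveOn ℝ (X k) (fun y => f l i (Function.update z k y))
  zeroSum : ∀ z : ∀ k, E k, (∀ k, z k ∈ X k) →
    gameCost f z = -((1 / (n 1 : ℝ)) * ∑ j, f 1 j z)

/-- Mixing matrices of one network: `W t` is doubly stochastic with weights at least `η` exactly
on the edges of `G t` (`Adj j i` is the edge from `j` to `i`), every agent is its own neighbour,
and the union of any `B` consecutive graphs is strongly connected. -/
structure IsNetworkMixing {n : ℕ} (η : ℝ) (B : ℕ) (G : ℕ → Digraph (Fin n))
    (W : ℕ → Matrix (Fin n) (Fin n) ℝ) : Prop where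
  selfLoop : ∀ t i, (G t).Adj i i
  weight_ge : ∀ t i j, (G t).Adj j i → η ≤ W t i j
  weight_eq_zero : ∀ t i j, ¬ (G t).Adj j i → W t i j = 0
  row_sum : ∀ t i, ∑ j, W t i j = 1
  col_sum : ∀ t j, ∑ i, W t i j = 1
  connected : ∀ k i j,
    Relation.ReflTransGen (fun a b => ∃ t, k ≤ t ∧ t < k + B ∧ (G t).Adj a b) i j

/-- Mixing matrices between the networks: `W l k t i j`, for `l ≠ k`, is the weight that the agent
`i` of the network `l` gives to the agent `j` of the network `k`. -/
structure IsCrossMixing {n : Fin 2 → ℕ} (G : ℕ → Digraph (Σ l, Fin (n l)))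
    (W : ∀ l k : Fin 2, ℕ → Matrix (Fin (n l)) (Fin (n k)) ℝ) : Prop where
  nonneg : ∀ l k, l ≠ k → ∀ t i j, 0 ≤ W l k t i j
  edge : ∀ l k, l ≠ k → ∀ t i j, 0 < W l k t i j → (G t).Adj ⟨k, j⟩ ⟨l, i⟩
  row_sum : ∀ l k, l ≠ k → ∀ t i, ∑ j, W l k t i j = 1

/-- The weighted averages formed by the agent `i` of the network `l` at time `t`. Its coordinate
`l` is `v_{l,i}(t)`, its other coordinate `k` is `u_{k,i}(t)`. -/
def averages {E : Fin 2 → Type*} [∀ l, NormedAddCommGroup (E l)] [∀ l, NormedSpace ℝ (E l)]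
    {Ω : Type*} {n : Fin 2 → ℕ} (W : ∀ l k : Fin 2, ℕ → Matrix (Fin (n l)) (Fin (n k)) ℝ)
    (x : ∀ l, Fin (n l) → ℕ → Ω → E l) (l : Fin 2) (i : Fin (n l)) (t : ℕ) (ω : Ω) :
    ∀ k, E k :=
  fun k => ∑ j, W l k t i j • x k j t ω

/-- The σ-algebra generated by the initial states and by the samples at the times `s < t`. -/
abbrev history {E : Fin 2 → Type*} [∀ l, MeasurableSpace (E l)] {Ω : Type*} {n : Fin 2 → ℕ} {d : ℕ}
    (x : ∀ l, Fin (n l) → ℕ → Ω → E l) (ξs : ∀ l, Fin (n l) → ℕ → Ω → Fin d → ℝ) (t : ℕ) :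
    MeasurableSpace Ω :=
  (⨆ l, ⨆ i, MeasurableSpace.comap (x l i 0) inferInstance) ⊔
    ⨆ l, ⨆ i, ⨆ s, ⨆ _ : s < t, MeasurableSpace.comap (ξs l i s) inferInstance

/-- The samples are independent and identically distributed copies of `ξ`. -/
structure IsIIDSample {Ω : Type*} [MeasurableSpace Ω] (P : Measure Ω) {n : Fin 2 → ℕ} {d : ℕ}
    (ξ : Ω → Fin d → ℝ) (ξs : ∀ l, Fin (n l) → ℕ → Ω → Fin d → ℝ) : Prop where
  measurable_source : Measurable ξ
  measurable : ∀ l i t, Measurable (ξs l i t)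
  indep : iIndepFun (fun (p : (Σ l, Fin (n l)) × ℕ) => ξs p.1.1 p.1.2 p.2) P
  identDistrib : ∀ l i t, IdentDistrib (ξs l i t) ξ P P

/-- The states `x` and the sampled subgradients `ghat` are generated by distributed stochastic
mirror descent with step sizes `α`, mixing matrices `W`, regularizers `ψ` and initial states `x₀`;
the sampled subgradient of time `t` is determined measurably by the information up to time `t`. -/
structure IsDSMD {E : Fin 2 → Type*} [∀ l, NormedAddCommGroup (E l)] [∀ l, NormedSpace ℝ (E l)]
    [∀ l, MeasurableSpace (E l)] {Ω : Type*} {n : Fin 2 → ℕ} {d : ℕ}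
    (X O : ∀ l, Set (E l)) (ψ : ∀ l, E l → ℝ)
    (Ψ : ∀ l, Fin (n l) → (∀ k, E k) → (Fin d → ℝ) → ℝ)
    (W : ∀ l k : Fin 2, ℕ → Matrix (Fin (n l)) (Fin (n k)) ℝ) (α : ℕ → ℝ)
    (ξs : ∀ l, Fin (n l) → ℕ → Ω → Fin d → ℝ) (x₀ : ∀ l, Fin (n l) → E l)
    (x : ∀ l, Fin (n l) → ℕ → Ω → E l)
    (ghat : ∀ l, Fin (n l) → ℕ → Ω → StrongDual ℝ (E l)) : Prop where
  init_mem : ∀ l i, x₀ l i ∈ X l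
  init : ∀ l i ω, x l i 0 ω = x₀ l i
  sample : ∀ l i t ω, ghat l i t ω ∈
    partialSubdiff O l (fun z => Ψ l i z (ξs l i t ω)) (averages W x l i t ω)
  sample_measurable : ∀ l i t, StronglyMeasurable[history x ξs (t + 1)] (ghat l i t)
  update : ∀ l i t ω, IsProx (X l) (ψ l) (averages W x l i t ω l) (-(α t • ghat l i t ω))
    (x l i (t + 1) ω)

/-- Lipschitz continuity of all agent costs on the product of the sets `O l`. -/
def LipschitzCosts {E : Fin 2 → Type*} [∀ l, NormedAddCommGroup (E l)] {n : Fin 2 → ℕ}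
    (O : ∀ l, Set (E l)) (f : ∀ l, Fin (n l) → (∀ k, E k) → ℝ) (L : ℝ) : Prop :=
  ∀ l i, ∀ z z' : ∀ k, E k, (∀ k, z k ∈ O k) → (∀ k, z' k ∈ O k) →
    |f l i z - f l i z'| ≤ L * (‖z 0 - z' 0‖ + ‖z 1 - z' 1‖)

/-- Given the past, the sampled subgradients `ghat` have conditional mean `g` and conditional
variance (in the dual norm) at most `ν l ^ 2`. -/
structure UnbiasedBoundedVariance {E : Fin 2 → Type*} [∀ l, NormedAddCommGroup (E l)]
    [∀ l, NormedSpace ℝ (E l)] {Ω : Type*} [MeasurableSpace Ω] (P : Measure Ω) {n : Fin 2 → ℕ}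
    (ℱ : ℕ → MeasurableSpace Ω) (ghat g : ∀ l, Fin (n l) → ℕ → Ω → StrongDual ℝ (E l))
    (ν : Fin 2 → ℝ) : Prop where
  integrable : ∀ l i t, Integrable (ghat l i t) P
  unbiased : ∀ l i t, P[ghat l i t | ℱ t] =ᵐ[P] g l i t
  integrable_sq : ∀ l i t, Integrable (fun ω => ‖g l i t ω - ghat l i t ω‖ ^ 2) P
  variance_le : ∀ l i t,
    P[fun ω => ‖g l i t ω - ghat l i t ω‖ ^ 2 | ℱ t] ≤ᵐ[P] fun _ => ν l ^ 2

/-- Convexity of the Bregman divergence in its second argument, and Bregman reciprocity. -/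
structure BregmanConvexReciprocal {E : Type*} [NormedAddCommGroup E] [NormedSpace ℝ E]
    (X : Set E) (ψ : E → ℝ) : Prop where
  convexOn : ∀ x ∈ X, ConvexOn ℝ X (fun y => bregman X ψ x y)
  reciprocity : ∀ x ∈ X, ∀ xs : ℕ → E, (∀ k, xs k ∈ X) → Tendsto xs atTop (𝓝 x) →
    Tendsto (fun k => bregman X ψ (xs k) x) atTop (𝓝 0)

/-- The pseudo regret up to time `T`, for the decisions `xi t` in the first network against the
received profiles `z t`, of which only the coordinate `1` matters. -/
def pseudoRegret {E : Fin 2 → Type*} {Ω : Type*} [MeasurableSpace Ω] (P : Measure Ω)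
    (X : ∀ l, Set (E l)) (U : (∀ k, E k) → ℝ) (xi : ℕ → Ω → E 0) (z : ℕ → Ω → ∀ k, E k)
    (T : ℕ) : ℝ :=
  (∫ ω, ∑ t ∈ Finset.Icc 1 T, U (Function.update (z t ω) 0 (xi t ω)) ∂P) -
    sInf ((fun x₁ => ∫ ω, ∑ t ∈ Finset.Icc 1 T, U (Function.update (z t ω) 0 x₁) ∂P) '' X 0)

/-- The constant `Γ = (1 - η / (4 n²))⁻²`. -/
def mixGamma (η : ℝ) (n : ℕ) : ℝ := (1 - η / (4 * (n : ℝ) ^ 2)) ^ (-2 : ℤ)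

/-- The rate `θ = (1 - η / (4 n²)) ^ (1 / B)`. -/
def mixTheta (η : ℝ) (n B : ℕ) : ℝ := (1 - η / (4 * (n : ℝ) ^ 2)) ^ (1 / (B : ℝ))

end

/-!
Let the values `x` of a network of `N` agents have mean zero. As long as no weight passes between
the agents below and above a gap in the sorted values, averaging keeps the two groups apart, and at
the first crossing the dispersions of the rows pick up at least `η` times the square of the gap.
Every gap is crossed within `B` steps, so `∑ xᵢ²` loses at least `η / 2` times the sum of the
squared gaps, and that sum is at least `∑ xᵢ² / N²`. Since `1 - η / (2 N²) ≤ (1 - η / (4 N²))²`,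
products of the weight matrices converge to the averaging matrix geometrically. A mirror step moves
an agent by at most `α(t) ‖ĝ‖`, and mixing these steps bounds the expected distance of the states to
the mean of their network.

In the regret of agent `i`, each cost `f_{1,j}` is linearized at the averages of agent `j`; by
Lipschitz continuity this costs `4 L` times the distance to the mean, in each network. The linear
terms may be evaluated at the sampled subgradients, because the averages are known at time `t` and
the samples are unbiased. By the three-point inequality for the prox map they telescope in the
Bregman divergences, divided by `α(t)`, and convexity of the divergence in its second argument makes
the averaging steps harmless.
-/

section Dispersion

variable {ι : Type*} [Fintype ι]

/-- The dispersion of the values `x` under the weights `w`, which is twice the variance of `x` when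
`w` is a probability vector. -/
def dispersion (w x : ι → ℝ) : ℝ :=
  ∑ i, ∑ j, w i * w j * (x i - x j) ^ 2

theorem dispersion_nonneg {w : ι → ℝ} (hw : ∀ i, 0 ≤ w i) (x : ι → ℝ) : 0 ≤ dispersion w x :=
  Finset.sum_nonneg fun i _ => Finset.sum_nonneg fun j _ =>
    mul_nonneg (mul_nonneg (hw i) (hw j)) (sq_nonneg _)

theorem dispersion_eq {w : ι → ℝ} (hw : ∑ i, w i = 1) (x : ι → ℝ) :
    dispersion w x = 2 * (∑ i, w i * x i ^ 2 - (∑ i, w i * x i) ^ 2) := by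
  have expand : ∀ i j, w i * w j * (x i - x j) ^ 2 =
      w j * (w i * x i ^ 2) + w i * (w j * x j ^ 2) - 2 * ((w i * x i) * (w j * x j)) :=
    fun i j => by ring
  simp only [dispersion, expand, Finset.sum_add_distrib, Finset.sum_sub_distrib, ← Finset.mul_sum,
    ← Finset.sum_mul, hw]
  ring

theorem le_dispersion_of_separated {w : ι → ℝ} (hw : w ∈ stdSimplex ℝ ι) {x : ι → ℝ} {S : Set ι}
    {a b η : ℝ} (hab : a ≤ b) (ha : ∀ i ∈ S, x i ≤ a) (hb : ∀ i ∉ S, b ≤ x i) {p q : ι}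
    (hp : p ∈ S) (hq : q ∉ S) (hwp : η ≤ w p) (hwq : η ≤ w q) :
    η * (b - a) ^ 2 ≤ dispersion w x := by
  have gap : ∀ i ∈ S, ∀ j ∉ S, (b - a) ^ 2 ≤ (x i - x j) ^ 2 := fun i hi j hj => by
    rw [sub_sq_comm (x i)]
    have := ha i hi
    have := hb j hj
    gcongr
  have term_le : ∀ i j, η ≤ w j → (b - a) ^ 2 ≤ (x i - x j) ^ 2 →
      η * (b - a) ^ 2 ≤ ∑ k, w k * (x i - x k) ^ 2 := fun i j hj h =>
    calc η * (b - a) ^ 2 ≤ w j * (b - a) ^ 2 := by gcongr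
      _ ≤ w j * (x i - x j) ^ 2 := mul_le_mul_of_nonneg_left h (hw.1 j)
      _ ≤ ∑ k, w k * (x i - x k) ^ 2 :=
          Finset.single_le_sum (f := fun k => w k * (x i - x k) ^ 2)
            (fun k _ => mul_nonneg (hw.1 k) (sq_nonneg _)) (Finset.mem_univ j)
  have row_le : ∀ i, η * (b - a) ^ 2 ≤ ∑ k, w k * (x i - x k) ^ 2 := fun i => by
    by_cases hi : i ∈ S
    · exact term_le i q hwq (gap i hi q hq)
    · exact term_le i p hwp (by rw [sub_sq_comm (x i)]; exact gap p hp i hi)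
  calc η * (b - a) ^ 2 = ∑ i, w i * (η * (b - a) ^ 2) := by rw [← Finset.sum_mul, hw.2, one_mul]
    _ ≤ ∑ i, w i * ∑ k, w k * (x i - x k) ^ 2 :=
        Finset.sum_le_sum fun i _ => mul_le_mul_of_nonneg_left (row_le i) (hw.1 i)
    _ = dispersion w x := by simp only [dispersion, Finset.mul_sum, mul_assoc]

variable [DecidableEq ι]

theorem row_mem_stdSimplex {A : Matrix ι ι ℝ} (hA : A ∈ doublyStochastic ℝ ι) (i : ι) :
    A i ∈ stdSimplex ℝ ι :=
  ⟨fun _ => nonneg_of_mem_doublyStochastic hA, sum_row_of_mem_doublyStochastic hA i⟩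

theorem sum_dispersion_rows {A : Matrix ι ι ℝ} (hA : A ∈ doublyStochastic ℝ ι) (x : ι → ℝ) :
    ∑ r, dispersion (A r) x = 2 * (∑ i, x i ^ 2 - ∑ i, A.mulVec x i ^ 2) := by
  simp only [fun r => dispersion_eq (sum_row_of_mem_doublyStochastic hA r) x,
    ← Finset.mul_sum, Finset.sum_sub_distrib, Matrix.mulVec, dotProduct]
  rw [Finset.sum_comm]
  simp only [← Finset.sum_mul, sum_col_of_mem_doublyStochastic hA, one_mul]

theorem sum_sq_mulVec_le {A : Matrix ι ι ℝ} (hA : A ∈ doublyStochastic ℝ ι) (x : ι → ℝ) :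
    ∑ i, A.mulVec x i ^ 2 ≤ ∑ i, x i ^ 2 := by
  have rows_nonneg : 0 ≤ ∑ r, dispersion (A r) x :=
    Finset.sum_nonneg fun r _ => dispersion_nonneg (row_mem_stdSimplex hA r).1 x
  linarith [sum_dispersion_rows hA x]

end Dispersion

section Clamp

/-- The point of the interval `[p, q]` nearest to `a`, for `p ≤ q`. Clamping to consecutive
intervals localizes a dispersion to the gaps between sorted values. -/
def clamp (p q a : ℝ) : ℝ :=
  max p (min a q)

theorem clamp_mono (p q : ℝ) : Monotone (clamp p q) := fun _ _ h =>
  max_le_max le_rfl (min_le_min h le_rfl)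

theorem clamp_of_le {p q a : ℝ} (h : a ≤ p) : clamp p q a = p :=
  max_eq_left ((min_le_left _ _).trans h)

theorem clamp_of_ge {p q a : ℝ} (hpq : p ≤ q) (h : q ≤ a) : clamp p q a = q := by
  rw [clamp, min_eq_right h, max_eq_right hpq]

theorem clamp_eq_min_sub_min_add {p q : ℝ} (hpq : p ≤ q) (a : ℝ) :
    clamp p q a = min a q - min a p + p := by
  rcases le_total a p with h | h
  · rw [clamp_of_le h, min_eq_left h, min_eq_left (h.trans hpq)]
    ring
  · rw [clamp, min_eq_right h, max_eq_right (le_min h hpq)]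
    ring

theorem sum_sq_clamp_sub_le {y : ℕ → ℝ} (hy : Monotone y) (a b : ℝ) (m : ℕ) :
    ∑ d ∈ Finset.range m, (clamp (y d) (y (d + 1)) a - clamp (y d) (y (d + 1)) b) ^ 2 ≤
      (a - b) ^ 2 := by
  wlog hab : b ≤ a generalizing a b
  · simpa only [sub_sq_comm] using this b a (le_of_not_ge hab)
  have diff_nonneg : ∀ d ∈ Finset.range m,
      0 ≤ clamp (y d) (y (d + 1)) a - clamp (y d) (y (d + 1)) b :=
    fun d _ => sub_nonneg.2 (clamp_mono _ _ hab)
  have telescope : ∑ d ∈ Finset.range m,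
      (clamp (y d) (y (d + 1)) a - clamp (y d) (y (d + 1)) b) =
        (min a (y m) - min b (y m)) - (min a (y 0) - min b (y 0)) := by
    rw [← Finset.sum_range_sub (fun d => min a (y d) - min b (y d))]
    refine Finset.sum_congr rfl fun d _ => ?_
    rw [clamp_eq_min_sub_min_add (hy d.le_succ), clamp_eq_min_sub_min_add (hy d.le_succ)]
    ring
  have sum_le : (min a (y m) - min b (y m)) - (min a (y 0) - min b (y 0)) ≤ a - b := by
    have : min b (y 0) ≤ min a (y 0) := min_le_min hab le_rfl
    have : min a (y m) - min b (y m) ≤ a - b := by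
      rcases min_cases a (y m) with h | h <;> rcases min_cases b (y m) with h' | h' <;> linarith
    linarith
  calc _ ≤ (∑ d ∈ Finset.range m,
          (clamp (y d) (y (d + 1)) a - clamp (y d) (y (d + 1)) b)) ^ 2 :=
        Finset.sum_sq_le_sq_sum_of_nonneg diff_nonneg
    _ ≤ (a - b) ^ 2 :=
        pow_le_pow_left₀ (Finset.sum_nonneg diff_nonneg) (telescope.trans_le sum_le) 2

theorem sum_dispersion_clamp_le {ι : Type*} [Fintype ι] {w : ι → ℝ} (hw : ∀ i, 0 ≤ w i)
    {y : ℕ → ℝ} (hy : Monotone y) (x : ι → ℝ) (m : ℕ) :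
    ∑ d ∈ Finset.range m, dispersion w (clamp (y d) (y (d + 1)) ∘ x) ≤ dispersion w x := by
  simp only [dispersion, Function.comp_apply]
  rw [Finset.sum_comm]
  refine Finset.sum_le_sum fun i _ => ?_
  rw [Finset.sum_comm]
  refine Finset.sum_le_sum fun j _ => ?_
  rw [← Finset.mul_sum]
  exact mul_le_mul_of_nonneg_left (sum_sq_clamp_sub_le hy _ _ _) (mul_nonneg (hw i) (hw j))

end Clamp

section SortedValues

variable {ι : Type*} [Fintype ι]

theorem abs_le_sub_of_sum_eq_zero {x : ι → ℝ} (hx : ∑ i, x i = 0) {lo hi : ℝ}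
    (hlo : ∀ i, lo ≤ x i) (hhi : ∀ i, x i ≤ hi) (i : ι) : |x i| ≤ hi - lo := by
  have univ_nonempty : (Finset.univ : Finset ι).Nonempty := ⟨i, Finset.mem_univ i⟩
  obtain ⟨p, -, hp⟩ := Finset.exists_le_of_sum_le univ_nonempty
    (f := x) (g := fun _ => 0) (by simp [hx])
  obtain ⟨q, -, hq⟩ := Finset.exists_le_of_sum_le univ_nonempty
    (f := fun _ => 0) (g := x) (by simp [hx])
  rw [abs_le]
  constructor <;> linarith [hlo i, hhi i, hlo p, hhi q]

theorem exists_monotone_enumeration [Nonempty ι] (x : ι → ℝ) :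
    ∃ y : ℕ → ℝ, Monotone y ∧ (∀ d, ∃ i, x i = y d) ∧ ∀ i, ∃ d < Fintype.card ι, x i = y d := by
  set e := Fintype.equivFin ι
  set σ := Tuple.sort (x ∘ e.symm)
  have hσ : Monotone ((x ∘ e.symm) ∘ σ) := Tuple.monotone_sort _
  have hcard := Fintype.card_pos (α := ι)
  let r : ℕ → Fin (Fintype.card ι) := fun d => ⟨min d (Fintype.card ι - 1), by omega⟩
  refine ⟨fun d => x (e.symm (σ (r d))), fun c d hcd => hσ ?_, fun d => ⟨_, rfl⟩, fun i => ?_⟩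
  · exact Fin.mk_le_mk.2 (min_le_min hcd le_rfl)
  · refine ⟨σ.symm (e i), Fin.is_lt _, ?_⟩
    have : r (σ.symm (e i)) = σ.symm (e i) :=
      Fin.ext (min_eq_left (Nat.le_sub_one_of_lt (Fin.is_lt _)))
    simp [this]

theorem sum_sq_le_card_sq_mul_sum_sq_gaps {x : ι → ℝ} (hx : ∑ i, x i = 0) {y : ℕ → ℝ}
    (hy : Monotone y) (hxy : ∀ i, ∃ d < Fintype.card ι, x i = y d) :
    ∑ i, x i ^ 2 ≤
      (Fintype.card ι : ℝ) ^ 2 * ∑ d ∈ Finset.range (Fintype.card ι), (y (d + 1) - y d) ^ 2 := by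
  set N := Fintype.card ι
  have range_bounds : ∀ i, y 0 ≤ x i ∧ x i ≤ y N := fun i => by
    obtain ⟨d, hd, h⟩ := hxy i
    exact h ▸ ⟨hy d.zero_le, hy hd.le⟩
  have sq_range : (y N - y 0) ^ 2 ≤ N * ∑ d ∈ Finset.range N, (y (d + 1) - y d) ^ 2 := by
    rw [← Finset.sum_range_sub y]
    simpa only [Finset.card_range] using
      sq_sum_le_card_mul_sum_sq (s := Finset.range N) (f := fun d => y (d + 1) - y d)
  calc ∑ i, x i ^ 2 ≤ ∑ _i : ι, (y N - y 0) ^ 2 := Finset.sum_le_sum fun i _ =>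
        sq_le_sq' (abs_le.1 (abs_le_sub_of_sum_eq_zero hx (fun i => (range_bounds i).1)
          (fun i => (range_bounds i).2) i)).1
          ((le_abs_self _).trans (abs_le_sub_of_sum_eq_zero hx (fun i => (range_bounds i).1)
          (fun i => (range_bounds i).2) i))
    _ = N * (y N - y 0) ^ 2 := by simp [N]
    _ ≤ N * (N * ∑ d ∈ Finset.range N, (y (d + 1) - y d) ^ 2) := by gcongr
    _ = _ := by ring

end SortedValues

section Mixing

variable {ι : Type*}

/-- The matrix `A` passes a value across the cut between `S` and its complement, in either
direction. -/
def Crosses (A : Matrix ι ι ℝ) (S : Set ι) : Prop :=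
  ∃ i j, (i ∈ S ↔ j ∉ S) ∧ A i j ≠ 0

theorem crosses_compl {A : Matrix ι ι ℝ} {S : Set ι} : Crosses A Sᶜ ↔ Crosses A S := by
  simp only [Crosses, Set.mem_compl_iff, not_iff_not]

variable [Fintype ι] [DecidableEq ι]

/-- The transition matrix over the `m` steps starting at time `s`, that is
`W (s + m - 1) * ⋯ * W s`. -/
def transition (W : ℕ → Matrix ι ι ℝ) (s : ℕ) : ℕ → Matrix ι ι ℝ
  | 0 => 1
  | m + 1 => W (s + m) * transition W s m

theorem transition_mem_doublyStochastic {W : ℕ → Matrix ι ι ℝ}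
    (hW : ∀ t, W t ∈ doublyStochastic ℝ ι) (s m : ℕ) :
    transition W s m ∈ doublyStochastic ℝ ι := by
  induction m with
  | zero => exact one_mem _
  | succ m ih => exact mul_mem (hW _) ih

theorem transition_add (W : ℕ → Matrix ι ι ℝ) (s m k : ℕ) :
    transition W s (m + k) = transition W (s + m) k * transition W s m := by
  induction k with
  | zero => exact (one_mul _).symm
  | succ k ih => rw [← add_assoc, transition, transition, ih, Matrix.mul_assoc, add_assoc]

theorem transition_succ_mulVec (W : ℕ → Matrix ι ι ℝ) (s m : ℕ) (x : ι → ℝ) :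
    (transition W s (m + 1)).mulVec x = (W (s + m)).mulVec ((transition W s m).mulVec x) :=
  (Matrix.mulVec_mulVec _ _ _).symm

theorem sum_dispersion_transition {W : ℕ → Matrix ι ι ℝ} (hW : ∀ t, W t ∈ doublyStochastic ℝ ι)
    (s m : ℕ) (x : ι → ℝ) :
    ∑ t ∈ Finset.range m, ∑ r, dispersion (W (s + t) r) ((transition W s t).mulVec x) =
      2 * (∑ i, x i ^ 2 - ∑ i, (transition W s m).mulVec x i ^ 2) := by
  have telescope :=
    Finset.sum_range_sub' (fun t => ∑ i, (transition W s t).mulVec x i ^ 2) m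
  simp only [transition, Matrix.one_mulVec] at telescope
  simp only [sum_dispersion_rows (hW _), ← transition_succ_mulVec, ← Finset.mul_sum, transition,
    telescope]

theorem mulVec_le_of_not_crosses {A : Matrix ι ι ℝ} (hA : A ∈ doublyStochastic ℝ ι) {S : Set ι}
    (hAS : ¬ Crosses A S) {x : ι → ℝ} {a : ℝ} (hx : ∀ i ∈ S, x i ≤ a) :
    ∀ i ∈ S, A.mulVec x i ≤ a := by
  intro i hi
  have off_cut : ∀ j ∉ S, A i j = 0 := fun j hj => by
    by_contra hne
    exact hAS ⟨i, j, by tauto, hne⟩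
  calc ∑ j, A i j * x j ≤ ∑ j, A i j * a := Finset.sum_le_sum fun j _ => by
        by_cases hj : j ∈ S
        · exact mul_le_mul_of_nonneg_left (hx j hj) (nonneg_of_mem_doublyStochastic hA)
        · simp [off_cut j hj]
    _ = a := by rw [← Finset.sum_mul, sum_row_of_mem_doublyStochastic hA, one_mul]

theorem transition_mulVec_le_of_not_crosses {W : ℕ → Matrix ι ι ℝ}
    (hW : ∀ t, W t ∈ doublyStochastic ℝ ι) {S : Set ι} {k s : ℕ}
    (hS : ∀ r < s, ¬ Crosses (W (k + r)) S) {x : ι → ℝ} {a : ℝ} (hx : ∀ i ∈ S, x i ≤ a) :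
    ∀ i ∈ S, (transition W k s).mulVec x i ≤ a := by
  induction s with
  | zero => simpa only [transition, Matrix.one_mulVec] using hx
  | succ s ih =>
    rw [transition_succ_mulVec]
    exact mulVec_le_of_not_crosses (hW _) (hS s s.lt_succ_self)
      (ih fun r hr => hS r (hr.trans s.lt_succ_self))

theorem le_transition_mulVec_of_not_crosses {W : ℕ → Matrix ι ι ℝ}
    (hW : ∀ t, W t ∈ doublyStochastic ℝ ι) {S : Set ι} {k s : ℕ}
    (hS : ∀ r < s, ¬ Crosses (W (k + r)) S) {x : ι → ℝ} {b : ℝ} (hx : ∀ i ∉ S, b ≤ x i) :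
    ∀ i ∉ S, b ≤ (transition W k s).mulVec x i := by
  intro i hi
  have := transition_mulVec_le_of_not_crosses hW (S := Sᶜ) (x := -x) (a := -b)
    (fun r hr => crosses_compl.not.2 (hS r hr)) (fun j hj => neg_le_neg (hx j hj)) i hi
  rw [Matrix.mulVec_neg] at this
  exact neg_le_neg_iff.1 this

/-- Doubly stochastic matrices whose nonzero and diagonal entries are at least `η` and which, within
any `B` consecutive steps, cross every proper cut. -/
structure IsUniformMixing (η : ℝ) (B : ℕ) (W : ℕ → Matrix ι ι ℝ) : Prop where
  mem_doublyStochastic : ∀ t, W t ∈ doublyStochastic ℝ ι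
  diag_ge : ∀ t i, η ≤ W t i i
  ge_of_ne_zero : ∀ t i j, W t i j ≠ 0 → η ≤ W t i j
  exists_crosses : ∀ k (S : Set ι), S.Nonempty → Sᶜ.Nonempty → ∃ s < B, Crosses (W (k + s)) S

namespace IsUniformMixing

variable {η : ℝ} {B : ℕ} {W : ℕ → Matrix ι ι ℝ}

theorem exists_first_crosses (hW : IsUniformMixing η B W) (k : ℕ) {S : Set ι} (hS : S.Nonempty)
    (hS' : Sᶜ.Nonempty) :
    ∃ s < B, Crosses (W (k + s)) S ∧ ∀ r < s, ¬ Crosses (W (k + r)) S := by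
  classical
  obtain ⟨s, hs, hcross⟩ := hW.exists_crosses k S hS hS'
  have hex : ∃ s, Crosses (W (k + s)) S := ⟨s, hcross⟩
  exact ⟨Nat.find hex, (Nat.find_min' hex hcross).trans_lt hs, Nat.find_spec hex,
    fun r hr => Nat.find_min hex hr⟩

theorem le_sum_dispersion_of_crosses (hW : IsUniformMixing η B W) {t : ℕ} {S : Set ι}
    (hcross : Crosses (W t) S) {x : ι → ℝ} {a b : ℝ} (hab : a ≤ b) (ha : ∀ i ∈ S, x i ≤ a)
    (hb : ∀ i ∉ S, b ≤ x i) :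
    η * (b - a) ^ 2 ≤ ∑ r, dispersion (W t r) x := by
  have row := fun r => row_mem_stdSimplex (hW.mem_doublyStochastic t) r
  obtain ⟨r, q, hrq, hne⟩ := hcross
  have hq := hW.ge_of_ne_zero t r q hne
  calc η * (b - a) ^ 2 ≤ dispersion (W t r) x := by
        by_cases hr : r ∈ S
        · exact le_dispersion_of_separated (row r) hab ha hb hr (hrq.1 hr) (hW.diag_ge t r) hq
        · exact le_dispersion_of_separated (row r) hab ha hb (by tauto : q ∈ S) hr hq
            (hW.diag_ge t r)
    _ ≤ ∑ r, dispersion (W t r) x :=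
        Finset.single_le_sum (f := fun r => dispersion (W t r) x)
          (fun r _ => dispersion_nonneg (row r).1 x) (Finset.mem_univ r)

-- Until the first crossing of the cut the two sides stay separated by `[a, b]`, so at that step
-- the clamped values equal `a` on one side and `b` on the other.
theorem le_sum_dispersion_clamp (hW : IsUniformMixing η B W) (k : ℕ) {x : ι → ℝ} {S : Set ι}
    (hS : S.Nonempty) (hS' : Sᶜ.Nonempty) {a b : ℝ} (hab : a ≤ b) (ha : ∀ i ∈ S, x i ≤ a)
    (hb : ∀ i ∉ S, b ≤ x i) :
    η * (b - a) ^ 2 ≤ ∑ s ∈ Finset.range B, ∑ r,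
      dispersion (W (k + s) r) (clamp a b ∘ (transition W k s).mulVec x) := by
  obtain ⟨s, hs, hcross, hfirst⟩ := hW.exists_first_crosses k hS hS'
  have hle := transition_mulVec_le_of_not_crosses hW.mem_doublyStochastic hfirst ha
  have hge := le_transition_mulVec_of_not_crosses hW.mem_doublyStochastic hfirst hb
  refine (hW.le_sum_dispersion_of_crosses hcross hab (fun i hi => (clamp_of_le (hle i hi)).le)
    fun i hi => (clamp_of_ge hab (hge i hi)).ge).trans
    (Finset.single_le_sum (f := fun s => ∑ r,
      dispersion (W (k + s) r) (clamp a b ∘ (transition W k s).mulVec x)) (fun t _ => ?_)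
      (Finset.mem_range.2 hs))
  exact Finset.sum_nonneg fun r _ =>
    dispersion_nonneg (row_mem_stdSimplex (hW.mem_doublyStochastic _) r).1 _

theorem gap_sq_le_sum_dispersion_clamp (hW : IsUniformMixing η B W) (k : ℕ) {x : ι → ℝ}
    {y : ℕ → ℝ} (hy : Monotone y) (hyx : ∀ d, ∃ i, x i = y d) (hxy : ∀ i, ∃ d, x i = y d)
    (d : ℕ) :
    η * (y (d + 1) - y d) ^ 2 ≤ ∑ s ∈ Finset.range B, ∑ r,
      dispersion (W (k + s) r) (clamp (y d) (y (d + 1)) ∘ (transition W k s).mulVec x) := by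
  rcases (hy d.le_succ).eq_or_lt with heq | hlt
  · rw [← heq, sub_self, zero_pow two_ne_zero, mul_zero]
    exact Finset.sum_nonneg fun s _ => Finset.sum_nonneg fun r _ =>
      dispersion_nonneg (row_mem_stdSimplex (hW.mem_doublyStochastic _) r).1 _
  · obtain ⟨p, hp⟩ := hyx d
    obtain ⟨q, hq⟩ := hyx (d + 1)
    refine hW.le_sum_dispersion_clamp k (S := {i | x i ≤ y d}) ⟨p, hp.le⟩
      ⟨q, fun h => (hq ▸ hlt).not_ge h⟩ hlt.le (fun i hi => hi) fun i hi => ?_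
    obtain ⟨e, he⟩ := hxy i
    rw [he]
    refine hy (Nat.succ_le_of_lt (lt_of_not_ge fun hed => hi ?_))
    exact he.le.trans (hy hed)

theorem sum_sq_transition_le (hW : IsUniformMixing η B W) (hη : 0 ≤ η) (k : ℕ) {x : ι → ℝ}
    (hx : ∑ i, x i = 0) :
    ∑ i, (transition W k B).mulVec x i ^ 2 ≤
      (1 - η / (2 * (Fintype.card ι : ℝ) ^ 2)) * ∑ i, x i ^ 2 := by
  cases isEmpty_or_nonempty ι
  · simp
  obtain ⟨y, hy, hyx, hxy⟩ := exists_monotone_enumeration x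
  set N := Fintype.card ι
  have gaps_le_decrease : η * ∑ d ∈ Finset.range N, (y (d + 1) - y d) ^ 2 ≤
      2 * (∑ i, x i ^ 2 - ∑ i, (transition W k B).mulVec x i ^ 2) :=
    calc η * ∑ d ∈ Finset.range N, (y (d + 1) - y d) ^ 2
        ≤ ∑ d ∈ Finset.range N, ∑ s ∈ Finset.range B, ∑ r, dispersion (W (k + s) r)
            (clamp (y d) (y (d + 1)) ∘ (transition W k s).mulVec x) := by
          rw [Finset.mul_sum]
          exact Finset.sum_le_sum fun d _ => hW.gap_sq_le_sum_dispersion_clamp k hy hyx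
            (fun i => (hxy i).imp fun _ h => h.2) d
      _ = ∑ s ∈ Finset.range B, ∑ r, ∑ d ∈ Finset.range N, dispersion (W (k + s) r)
            (clamp (y d) (y (d + 1)) ∘ (transition W k s).mulVec x) := by
          rw [Finset.sum_comm]
          exact Finset.sum_congr rfl fun s _ => Finset.sum_comm
      _ ≤ ∑ s ∈ Finset.range B, ∑ r,
            dispersion (W (k + s) r) ((transition W k s).mulVec x) :=
          Finset.sum_le_sum fun s _ => Finset.sum_le_sum fun r _ =>
            sum_dispersion_clamp_le (row_mem_stdSimplex (hW.mem_doublyStochastic _) r).1 hy _ _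
      _ = _ := sum_dispersion_transition hW.mem_doublyStochastic k B x
  have norm_le_gaps : η / (2 * (N : ℝ) ^ 2) * ∑ i, x i ^ 2 ≤
      η / 2 * ∑ d ∈ Finset.range N, (y (d + 1) - y d) ^ 2 := by
    have hN : (0 : ℝ) < N := by exact_mod_cast Fintype.card_pos
    refine (mul_le_mul_of_nonneg_left (sum_sq_le_card_sq_mul_sum_sq_gaps hx hy hxy)
      (by positivity)).trans (le_of_eq ?_)
    field_simp
    rfl
  linarith

theorem sum_sq_transition_mul_le (hW : IsUniformMixing η B W) (hη : 0 ≤ η) (s : ℕ) {x : ι → ℝ}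
    (hx : ∑ i, x i = 0) (q : ℕ) :
    ∑ i, (transition W s (q * B)).mulVec x i ^ 2 ≤
      ((1 - η / (4 * (Fintype.card ι : ℝ) ^ 2)) ^ q) ^ 2 * ∑ i, x i ^ 2 := by
  set β := 1 - η / (4 * (Fintype.card ι : ℝ) ^ 2) with hβ
  have rate_le : 1 - η / (2 * (Fintype.card ι : ℝ) ^ 2) ≤ β ^ 2 := by
    have : η / (2 * (Fintype.card ι : ℝ) ^ 2) = 2 * (1 - β) := by rw [hβ]; ring
    nlinarith [sq_nonneg (1 - β)]
  induction q with
  | zero => simp [transition]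
  | succ q ih =>
    have sum_zero : ∑ i, (transition W s (q * B)).mulVec x i = 0 := by
      rw [sum_mulVec_of_mem_doublyStochastic
        (transition_mem_doublyStochastic hW.mem_doublyStochastic _ _), hx]
    rw [add_mul, one_mul, transition_add, ← Matrix.mulVec_mulVec]
    calc _ ≤ (1 - η / (2 * (Fintype.card ι : ℝ) ^ 2)) *
          ∑ i, (transition W s (q * B)).mulVec x i ^ 2 := hW.sum_sq_transition_le hη _ sum_zero
      _ ≤ β ^ 2 * ((β ^ q) ^ 2 * ∑ i, x i ^ 2) := by gcongr
      _ = _ := by ring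

theorem abs_transition_sub_le (hW : IsUniformMixing η B W) (hη0 : 0 ≤ η)
    (hη1 : η / (4 * (Fintype.card ι : ℝ) ^ 2) ≤ 1) (s m : ℕ) (i j : ι) :
    |transition W s m i j - 1 / Fintype.card ι| ≤
      (1 - η / (4 * (Fintype.card ι : ℝ) ^ 2)) ^ (m / B) := by
  set N := Fintype.card ι
  set β := 1 - η / (4 * (N : ℝ) ^ 2)
  have hN : (0 : ℝ) < N := by exact_mod_cast Fintype.card_pos_iff.2 ⟨i⟩
  have hT := transition_mem_doublyStochastic hW.mem_doublyStochastic
  let x : ι → ℝ := Pi.single j 1 - fun _ => 1 / (N : ℝ)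
  have sum_x : ∑ i, x i = 0 := by simp [x, N, Finset.sum_sub_distrib, hN.ne']
  have sum_sq_x : ∑ i, x i ^ 2 ≤ 1 := by
    have sq_eq : ∀ i, x i ^ 2 = (if i = j then 1 - 2 * (1 / (N : ℝ)) else 0) + (1 / (N : ℝ)) ^ 2 :=
      fun i => by
        simp only [x, Pi.sub_apply, Pi.single_apply]
        split_ifs <;> ring
    have : (N : ℝ) * (1 / (N : ℝ)) ^ 2 = 1 / N := by field_simp
    simp only [sq_eq, Finset.sum_add_distrib, Finset.sum_ite_eq', Finset.mem_univ, if_true,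
      Finset.sum_const, Finset.card_univ, nsmul_eq_mul]
    linarith [one_div_pos.2 hN]
  have entry_eq : transition W s m i j - 1 / N = (transition W s m).mulVec x i := by
    simp only [x, Matrix.mulVec, dotProduct, Pi.sub_apply, mul_sub, Finset.sum_sub_distrib,
      ← Finset.sum_mul, sum_row_of_mem_doublyStochastic (hT s m), one_mul]
    simp [Pi.single_apply]
  refine abs_le_of_sq_le_sq ?_ (pow_nonneg (by linarith) _)
  calc (transition W s m i j - 1 / N) ^ 2 = (transition W s m).mulVec x i ^ 2 := by rw [entry_eq]
    _ ≤ ∑ i, (transition W s m).mulVec x i ^ 2 :=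
        Finset.single_le_sum (f := fun i => (transition W s m).mulVec x i ^ 2)
          (fun i _ => sq_nonneg _) (Finset.mem_univ i)
    _ ≤ ∑ i, (transition W s (m / B * B)).mulVec x i ^ 2 := by
        conv_lhs => rw [← Nat.div_add_mod' m B, transition_add, ← Matrix.mulVec_mulVec]
        exact sum_sq_mulVec_le (hT _ _) _
    _ ≤ (β ^ (m / B)) ^ 2 * ∑ i, x i ^ 2 := hW.sum_sq_transition_mul_le hη0 s sum_x _
    _ ≤ (β ^ (m / B)) ^ 2 := mul_le_of_le_one_right (sq_nonneg _) sum_sq_x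

end IsUniformMixing

end Mixing

section NetworkMixing

variable {n : ℕ} {η : ℝ} {B : ℕ}

theorem exists_edge_of_reflTransGen {β : Type*} {r : β → β → Prop} {S : Set β} {a b : β}
    (h : Relation.ReflTransGen r a b) (ha : a ∉ S) (hb : b ∈ S) : ∃ i ∉ S, ∃ j ∈ S, r i j := by
  induction h with
  | refl => exact absurd hb ha
  | @tail b c _ hbc ih =>
    by_cases hbS : b ∈ S
    · exact ih hbS
    · exact ⟨b, hbS, c, hb, hbc⟩

theorem IsNetworkMixing.isUniformMixing (hη : 0 < η) {G : ℕ → Digraph (Fin n)}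
    {W : ℕ → Matrix (Fin n) (Fin n) ℝ} (hW : IsNetworkMixing η B G W) : IsUniformMixing η B W where
  mem_doublyStochastic t := by
    refine mem_doublyStochastic_iff_sum.2 ⟨fun i j => ?_, hW.row_sum t, hW.col_sum t⟩
    by_cases hadj : (G t).Adj j i
    · exact hη.le.trans (hW.weight_ge t i j hadj)
    · exact (hW.weight_eq_zero t i j hadj).ge
  diag_ge t i := hW.weight_ge t i i (hW.selfLoop t i)
  ge_of_ne_zero t i j hne :=
    hW.weight_ge t i j (not_not.1 fun hadj => hne (hW.weight_eq_zero t i j hadj))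
  exists_crosses k S := by
    rintro ⟨b, hb⟩ ⟨a, ha⟩
    obtain ⟨j, hj, i, hi, t, hkt, htk, hadj⟩ :=
      exists_edge_of_reflTransGen (hW.connected k a b) ha hb
    obtain ⟨s, rfl⟩ := Nat.exists_eq_add_of_le hkt
    exact ⟨s, by omega, i, j, by tauto, (hη.trans_le (hW.weight_ge _ i j hadj)).ne'⟩

theorem div_four_mul_sq_lt_one (hη1 : η < 1) (n : ℕ) : η / (4 * (n : ℝ) ^ 2) < 1 := by
  rcases n.eq_zero_or_pos with rfl | hn
  · simp
  · have : (1 : ℝ) ≤ n := by exact_mod_cast hn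
    rw [div_lt_one (by positivity)]
    nlinarith

-- The factor `Γ`, the inverse square of the base, absorbs the rounding in `m / B`.
theorem pow_div_le_mixGamma_mul_mixTheta_pow (hη0 : 0 ≤ η) (hη1 : η < 1) (n : ℕ) (hB : 1 ≤ B)
    (m : ℕ) : (1 - η / (4 * (n : ℝ) ^ 2)) ^ (m / B) ≤ mixGamma η n * mixTheta η n B ^ m := by
  have base_pos : 0 < 1 - η / (4 * (n : ℝ) ^ 2) := sub_pos.2 (div_four_mul_sq_lt_one hη1 n)
  have base_le_one : 1 - η / (4 * (n : ℝ) ^ 2) ≤ 1 := sub_le_self _ (by positivity)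
  unfold mixGamma mixTheta
  set β := 1 - η / (4 * (n : ℝ) ^ 2)
  rw [← Real.rpow_natCast (β ^ (1 / (B : ℝ))), ← Real.rpow_mul base_pos.le, ← Real.rpow_intCast,
    ← Real.rpow_add base_pos, ← Real.rpow_natCast]
  refine Real.rpow_le_rpow_of_exponent_ge base_pos base_le_one ?_
  have div_lt : 1 / (B : ℝ) * m < ((m / B : ℕ) : ℝ) + 1 := by
    rw [one_div_mul_eq_div, div_lt_iff₀ (by exact_mod_cast hB)]
    exact_mod_cast mul_comm B (m / B + 1) ▸ Nat.lt_mul_div_succ m hB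
  push_cast
  linarith

end NetworkMixing

section GeometricMixing

variable {ι : Type*} [Fintype ι] [DecidableEq ι]

/-- Doubly stochastic matrices whose backward products approach the averaging matrix at the
geometric rate `Γ * θ ^ m`, uniformly in the starting time. -/
structure IsGeometricMixing (Γ θ : ℝ) (W : ℕ → Matrix ι ι ℝ) : Prop where
  mem_doublyStochastic : ∀ t, W t ∈ doublyStochastic ℝ ι
  scale_nonneg : 0 ≤ Γ
  rate_nonneg : 0 ≤ θ
  rate_le_one : θ ≤ 1
  abs_transition_sub_le : ∀ s m i j, |transition W s m i j - 1 / Fintype.card ι| ≤ Γ * θ ^ m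

theorem IsNetworkMixing.isGeometricMixing {n : ℕ} {η : ℝ} (hη0 : 0 < η) (hη1 : η < 1) {B : ℕ}
    (hB : 1 ≤ B) {G : ℕ → Digraph (Fin n)} {W : ℕ → Matrix (Fin n) (Fin n) ℝ}
    (hW : IsNetworkMixing η B G W) : IsGeometricMixing (mixGamma η n) (mixTheta η n B) W := by
  have base_nonneg : 0 ≤ 1 - η / (4 * (n : ℝ) ^ 2) :=
    sub_nonneg.2 (div_four_mul_sq_lt_one hη1 n).le
  refine ⟨(hW.isUniformMixing hη0).mem_doublyStochastic, zpow_nonneg base_nonneg _,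
    Real.rpow_nonneg base_nonneg _, ?_, fun s m i j => ?_⟩
  · exact Real.rpow_le_one base_nonneg (sub_le_self _ (by positivity)) (by positivity)
  · refine le_trans ?_ (pow_div_le_mixGamma_mul_mixTheta_pow hη0.le hη1 n hB m)
    have decay := (hW.isUniformMixing hη0).abs_transition_sub_le hη0.le
      (by simpa only [Fintype.card_fin] using (div_four_mul_sq_lt_one hη1 n).le) s m i j
    simpa only [Fintype.card_fin] using decay

namespace IsGeometricMixing

variable {Γ θ : ℝ} {W : ℕ → Matrix ι ι ℝ}

theorem sum_abs_transition_succ_sub_le (hW : IsGeometricMixing Γ θ W) (s m : ℕ) (i : ι) :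
    ∑ j, |transition W s (m + 1) i j - 1 / Fintype.card ι| ≤ Fintype.card ι * Γ * θ ^ m :=
  calc ∑ j, |transition W s (m + 1) i j - 1 / Fintype.card ι|
      ≤ ∑ _j : ι, Γ * θ ^ m := Finset.sum_le_sum fun j _ =>
        (hW.abs_transition_sub_le s (m + 1) i j).trans (mul_le_mul_of_nonneg_left
          (pow_le_pow_of_le_one hW.rate_nonneg hW.rate_le_one m.le_succ) hW.scale_nonneg)
    _ = Fintype.card ι * Γ * θ ^ m := by
        rw [Finset.sum_const, Finset.card_univ, nsmul_eq_mul, mul_assoc]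

theorem sum_abs_transition_sub_le_two (hW : IsGeometricMixing Γ θ W) (s m : ℕ) (i : ι) :
    ∑ j, |transition W s m i j - 1 / Fintype.card ι| ≤ 2 := by
  have hT := transition_mem_doublyStochastic hW.mem_doublyStochastic s m
  have hN : (0 : ℝ) < Fintype.card ι := by exact_mod_cast Fintype.card_pos_iff.2 ⟨i⟩
  calc ∑ j, |transition W s m i j - 1 / Fintype.card ι|
      ≤ ∑ j, (transition W s m i j + 1 / Fintype.card ι) := Finset.sum_le_sum fun j _ => by
        refine (abs_sub _ _).trans_eq ?_
        rw [abs_of_nonneg (nonneg_of_mem_doublyStochastic hT), abs_of_pos (by positivity)]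
    _ = 2 := by
        rw [Finset.sum_add_distrib, sum_row_of_mem_doublyStochastic hT, Finset.sum_const,
          Finset.card_univ, nsmul_eq_mul, mul_one_div_cancel hN.ne']
        norm_num

end IsGeometricMixing

end GeometricMixing

section PerturbedAveraging

variable {ι : Type*} [Fintype ι]

/-- The uniform average of the states in a network. -/
noncomputable def networkMean {E : Type*} [AddCommGroup E] [Module ℝ E] (y : ι → E) : E :=
  (1 / (Fintype.card ι : ℝ)) • ∑ j, y j

theorem norm_sum_smul_le_sum_abs_mul_norm {E : Type*} [SeminormedAddCommGroup E] [NormedSpace ℝ E]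
    (w : ι → ℝ) (v : ι → E) : ‖∑ j, w j • v j‖ ≤ ∑ j, |w j| * ‖v j‖ :=
  (norm_sum_le _ _).trans_eq (by simp only [norm_smul, Real.norm_eq_abs])

variable [DecidableEq ι]

section Module

variable {E : Type*} [AddCommGroup E] [Module ℝ E] {W : ℕ → Matrix ι ι ℝ} {y e : ℕ → ι → E}

theorem sum_transition_succ_smul (W : ℕ → Matrix ι ι ℝ) (s m : ℕ) (i : ι) (v : ι → E) :
    ∑ j, transition W s (m + 1) i j • v j =
      ∑ k, W (s + m) i k • ∑ j, transition W s m k j • v j := by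
  simp only [transition, Matrix.mul_apply, Finset.sum_smul, Finset.smul_sum, smul_smul]
  rw [Finset.sum_comm]

theorem sum_transition_zero_smul (W : ℕ → Matrix ι ι ℝ) (s : ℕ) (i : ι) (v : ι → E) :
    ∑ j, transition W s 0 i j • v j = v i := by
  simp [transition, Matrix.one_apply]

theorem perturbed_averaging_eq (hy : ∀ t i, y (t + 1) i = ∑ j, W t i j • y t j + e t i) (t : ℕ)
    (i : ι) :
    y t i = ∑ j, transition W 0 t i j • y 0 j +
      ∑ s ∈ Finset.range t, ∑ j, transition W (s + 1) (t - 1 - s) i j • e s j := by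
  induction t generalizing i with
  | zero => simp [sum_transition_zero_smul]
  | succ t ih =>
    have past : ∀ s ∈ Finset.range t,
        ∑ j, transition W (s + 1) (t + 1 - 1 - s) i j • e s j =
          ∑ k, W t i k • ∑ j, transition W (s + 1) (t - 1 - s) k j • e s j := fun s hs => by
      have hst := Finset.mem_range.1 hs
      rw [show t + 1 - 1 - s = t - 1 - s + 1 by omega, sum_transition_succ_smul,
        show s + 1 + (t - 1 - s) = t by omega]
    rw [hy, Finset.sum_range_succ, Finset.sum_congr rfl past, sum_transition_succ_smul,
      Nat.add_sub_cancel, Nat.sub_self, sum_transition_zero_smul, zero_add, Finset.sum_comm,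
      ← add_assoc, ← Finset.sum_add_distrib]
    simp only [← Finset.smul_sum, ← smul_add, ← ih]

theorem sum_perturbed_averaging (hW : ∀ t, W t ∈ doublyStochastic ℝ ι)
    (hy : ∀ t i, y (t + 1) i = ∑ j, W t i j • y t j + e t i) (t : ℕ) :
    ∑ i, y t i = ∑ j, y 0 j + ∑ s ∈ Finset.range t, ∑ j, e s j := by
  induction t with
  | zero => simp
  | succ t ih =>
    simp only [hy, Finset.sum_add_distrib]
    rw [Finset.sum_comm]
    simp only [← Finset.sum_smul, sum_col_of_mem_doublyStochastic (hW t), one_smul, ih,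
      Finset.sum_range_succ, add_assoc]

theorem perturbed_averaging_sub_networkMean (hW : ∀ t, W t ∈ doublyStochastic ℝ ι)
    (hy : ∀ t i, y (t + 1) i = ∑ j, W t i j • y t j + e t i) (t : ℕ) (i : ι) :
    y t i - networkMean (y t) =
      ∑ j, (transition W 0 t i j - 1 / Fintype.card ι) • y 0 j + ∑ s ∈ Finset.range t,
        ∑ j, (transition W (s + 1) (t - 1 - s) i j - 1 / Fintype.card ι) • e s j := by
  rw [networkMean, sum_perturbed_averaging hW hy t, perturbed_averaging_eq hy t i]
  simp only [sub_smul, Finset.sum_sub_distrib, smul_add, Finset.smul_sum]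
  abel

end Module

theorem norm_sub_networkMean_le {E : Type*} [NormedAddCommGroup E] [NormedSpace ℝ E]
    {W : ℕ → Matrix ι ι ℝ} (hW : ∀ t, W t ∈ doublyStochastic ℝ ι) (y : ℕ → ι → E) (t : ℕ) (i : ι) :
    ‖y t i - networkMean (y t)‖ ≤
      ∑ j, |transition W 0 t i j - 1 / Fintype.card ι| * ‖y 0 j‖ + ∑ s ∈ Finset.range t,
        ∑ j, |transition W (s + 1) (t - 1 - s) i j - 1 / Fintype.card ι| *
          ‖y (s + 1) j - ∑ k, W s j k • y s k‖ := by
  rw [perturbed_averaging_sub_networkMean hW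
    (e := fun t i => y (t + 1) i - ∑ j, W t i j • y t j) (fun t i => by abel)]
  refine (norm_add_le _ _).trans (add_le_add (norm_sum_smul_le_sum_abs_mul_norm _ _) ?_)
  exact (norm_sum_le _ _).trans
    (Finset.sum_le_sum fun s _ => norm_sum_smul_le_sum_abs_mul_norm _ _)

end PerturbedAveraging

section Disagreement

variable {ι : Type*} [Fintype ι] [DecidableEq ι]

/-- The bound on the expected distance of a state at time `t ≥ 1` to the mean of its network of `N`
agents, if the initial states have norm at most `Λ` and the step of time `s` has expected length at
most `α s * c`. The last step, which has not been mixed yet, contributes the last term. -/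
def disagreementBound (N : ℕ) (Γ θ Λ c : ℝ) (α : ℕ → ℝ) (t : ℕ) : ℝ :=
  N * Γ * θ ^ (t - 1) * Λ + N * Γ * c * ∑ s ∈ Finset.Icc 1 (t - 1), θ ^ (t - 1 - s) * α (s - 1) +
    2 * c * α (t - 1)

theorem sum_Icc_one_eq_sum_range {M : Type*} [AddCommMonoid M] (F : ℕ → M) (m : ℕ) :
    ∑ s ∈ Finset.Icc 1 m, F s = ∑ s ∈ Finset.range m, F (s + 1) := by
  rw [Finset.range_eq_Ico, Finset.sum_Ico_add' F 0 m 1, zero_add, Finset.Ico_add_one_right_eq_Icc]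

theorem IsGeometricMixing.sum_abs_transition_mul_le_disagreementBound {Γ θ Λ c : ℝ}
    {W : ℕ → Matrix ι ι ℝ} (hW : IsGeometricMixing Γ θ W) (hΛ : 0 ≤ Λ) (hc : 0 ≤ c) {α : ℕ → ℝ}
    (hα : ∀ t, 0 ≤ α t) {t : ℕ} (ht : 1 ≤ t) (i : ι) :
    ∑ j, |transition W 0 t i j - 1 / Fintype.card ι| * Λ + ∑ s ∈ Finset.range t,
        ∑ j, |transition W (s + 1) (t - 1 - s) i j - 1 / Fintype.card ι| * (α s * c) ≤
      disagreementBound (Fintype.card ι) Γ θ Λ c α t := by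
  obtain ⟨t, rfl⟩ := Nat.exists_eq_add_of_le' ht
  simp only [disagreementBound, ← Finset.sum_mul, Finset.sum_range_succ, Nat.add_sub_cancel]
  have initial := mul_le_mul_of_nonneg_right (hW.sum_abs_transition_succ_sub_le 0 t i) hΛ
  have last := mul_le_mul_of_nonneg_right (hW.sum_abs_transition_sub_le_two (t + 1) (t - t) i)
    (mul_nonneg (hα t) hc)
  have intermediate : ∑ s ∈ Finset.range t,
      (∑ j, |transition W (s + 1) (t - s) i j - 1 / Fintype.card ι|) * (α s * c) ≤
      Fintype.card ι * Γ * c * ∑ s ∈ Finset.Icc 1 t, θ ^ (t - s) * α (s - 1) := by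
    rw [sum_Icc_one_eq_sum_range, Finset.mul_sum]
    refine Finset.sum_le_sum fun s hs => ?_
    have hst := Finset.mem_range.1 hs
    rw [show t - s = t - (s + 1) + 1 by omega, Nat.add_sub_cancel]
    refine (mul_le_mul_of_nonneg_right (hW.sum_abs_transition_succ_sub_le (s + 1) _ i)
      (mul_nonneg (hα s) hc)).trans_eq ?_
    ring
  linarith

theorem IsGeometricMixing.integral_norm_sub_networkMean_le {E : Type*} [NormedAddCommGroup E]
    [NormedSpace ℝ E] {Ω : Type*} [MeasurableSpace Ω] {P : Measure Ω} [IsProbabilityMeasure P]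
    {Γ θ Λ c : ℝ} {W : ℕ → Matrix ι ι ℝ} (hW : IsGeometricMixing Γ θ W) (hΛ : 0 ≤ Λ) (hc : 0 ≤ c)
    {α : ℕ → ℝ} (hα : ∀ t, 0 ≤ α t) {x : ι → ℕ → Ω → E} (hx : ∀ i t, Integrable (x i t) P)
    (hinit : ∀ i ω, ‖x i 0 ω‖ ≤ Λ)
    (hstep : ∀ i t, ∫ ω, ‖x i (t + 1) ω - ∑ j, W t i j • x j t ω‖ ∂P ≤ α t * c) {t : ℕ}
    (ht : 1 ≤ t) (i : ι) :
    ∫ ω, ‖x i t ω - networkMean (fun j => x j t ω)‖ ∂P ≤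
      disagreementBound (Fintype.card ι) Γ θ Λ c α t := by
  refine le_trans ?_ (hW.sum_abs_transition_mul_le_disagreementBound hΛ hc hα ht i)
  set D : ℕ → ℕ → ι → ℝ := fun s m j => |transition W s m i j - 1 / Fintype.card ι|
  have hterm : ∀ s j, Integrable (fun ω => D (s + 1) (t - 1 - s) j *
      ‖x j (s + 1) ω - ∑ k, W s j k • x k s ω‖) P := fun s j =>
    ((hx j (s + 1)).sub
      (integrable_finsetSum _ fun k _ => (hx k s).smul (W s j k))).norm.const_mul _
  have hsum : Integrable (fun ω => ∑ s ∈ Finset.range t, ∑ j, D (s + 1) (t - 1 - s) j *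
      ‖x j (s + 1) ω - ∑ k, W s j k • x k s ω‖) P :=
    integrable_finsetSum _ fun s _ => integrable_finsetSum _ fun j _ => hterm s j
  calc ∫ ω, ‖x i t ω - networkMean (fun j => x j t ω)‖ ∂P
      ≤ ∫ ω, (∑ j, D 0 t j * Λ + ∑ s ∈ Finset.range t, ∑ j, D (s + 1) (t - 1 - s) j *
          ‖x j (s + 1) ω - ∑ k, W s j k • x k s ω‖) ∂P := by
        refine integral_mono ?_ ((integrable_const _).add hsum) fun ω => ?_
        · exact ((hx i t).sub ((integrable_finsetSum _ fun j _ => hx j t).smul _)).norm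
        · refine (norm_sub_networkMean_le hW.mem_doublyStochastic
            (fun t i => x i t ω) t i).trans (add_le_add_left (Finset.sum_le_sum fun j _ => ?_) _)
          exact mul_le_mul_of_nonneg_left (hinit j ω) (abs_nonneg _)
    _ = ∑ j, D 0 t j * Λ + ∑ s ∈ Finset.range t, ∑ j, D (s + 1) (t - 1 - s) j *
          ∫ ω, ‖x j (s + 1) ω - ∑ k, W s j k • x k s ω‖ ∂P := by
        rw [integral_add (integrable_const _) hsum, integral_const, probReal_univ, one_smul,
          integral_finsetSum _ fun s _ => integrable_finsetSum _ fun j _ => hterm s j]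
        simp only [integral_finsetSum _ fun j _ => hterm _ j, integral_const_mul]
    _ ≤ _ := add_le_add_right (Finset.sum_le_sum fun s _ => Finset.sum_le_sum fun j _ =>
        mul_le_mul_of_nonneg_left (hstep j s) (abs_nonneg _)) _

end Disagreement

section Prox

variable {E : Type*} [NormedAddCommGroup E] [NormedSpace ℝ E] {X : Set E} {ψ : E → ℝ}

theorem tendsto_slope_fderivWithin (hX : Convex ℝ X) {p q : E} (hp : p ∈ X) (hq : q ∈ X)
    (hψ : DifferentiableWithinAt ℝ ψ X p) :
    Tendsto (fun τ : ℝ => τ⁻¹ * (ψ (p + τ • (q - p)) - ψ p)) (𝓝[>] 0)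
      (𝓝 (fderivWithin ℝ ψ X p (q - p))) := by
  have continuous_direction : Continuous fun τ : ℝ => τ • (q - p) := by fun_prop
  refine hψ.hasFDerivWithinAt.lim (c := fun τ : ℝ => τ⁻¹) (d := fun τ : ℝ => τ • (q - p)) ?_ ?_ ?_
  · exact (continuous_direction.tendsto' 0 0 (zero_smul ℝ _)).mono_left nhdsWithin_le_nhds
  · filter_upwards [Ioc_mem_nhdsGT zero_lt_one] with τ hτ
    exact hX.add_smul_sub_mem hp hq ⟨hτ.1.le, hτ.2⟩
  · refine tendsto_const_nhds.congr' ?_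
    filter_upwards [self_mem_nhdsWithin] with τ hτ
    rw [smul_smul, inv_mul_cancel₀ (ne_of_gt hτ), one_smul]

theorem bregman_self (x : E) : bregman X ψ x x = 0 := by
  simp only [bregman, sub_self, map_zero]

theorem bregman_three_point (x p q : E) :
    bregman X ψ q p = bregman X ψ x p + bregman X ψ q x +
      (fderivWithin ℝ ψ X x (q - x) - fderivWithin ℝ ψ X p (q - x)) := by
  unfold bregman
  rw [← sub_add_sub_cancel q x p, map_add]
  ring

theorem IsRegularizer.half_norm_sub_sq_le_bregman (hψ : IsRegularizer X ψ) {x p : E} (hx : x ∈ X)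
    (hp : p ∈ X) : 1 / 2 * ‖x - p‖ ^ 2 ≤ bregman X ψ x p := by
  have slope_le : ∀ᶠ τ : ℝ in 𝓝[>] 0, τ⁻¹ * (ψ (p + τ • (x - p)) - ψ p) ≤
      ψ x - ψ p - (1 - τ) * (1 / 2 * ‖x - p‖ ^ 2) := by
    filter_upwards [Ioc_mem_nhdsGT zero_lt_one] with τ hτ
    have convexity := hψ.strongConvexOn.2 hp hx (sub_nonneg.2 hτ.2) hτ.1.le (sub_add_cancel 1 τ)
    rw [show (1 - τ) • p + τ • x = p + τ • (x - p) by module, norm_sub_rev p x] at convexity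
    simp only [smul_eq_mul] at convexity
    rw [inv_mul_le_iff₀ hτ.1]
    linarith
  have bound_tendsto : Tendsto (fun τ : ℝ => ψ x - ψ p - (1 - τ) * (1 / 2 * ‖x - p‖ ^ 2)) (𝓝[>] 0)
      (𝓝 (ψ x - ψ p - (1 - 0) * (1 / 2 * ‖x - p‖ ^ 2))) :=
    (Continuous.tendsto (by fun_prop) 0).mono_left nhdsWithin_le_nhds
  have := le_of_tendsto_of_tendsto (tendsto_slope_fderivWithin hψ.strongConvexOn.1 hp hx
    (hψ.differentiableOn p hp)) bound_tendsto slope_le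
  unfold bregman
  linarith

namespace IsProx

variable {v z q : E} {y : StrongDual ℝ E}

theorem apply_sub_le_fderivWithin_sub (hz : IsProx X ψ v y z) (hX : Convex ℝ X)
    (hψ : DifferentiableWithinAt ℝ ψ X z) (hq : q ∈ X) :
    y (q - z) ≤ fderivWithin ℝ ψ X z (q - z) - fderivWithin ℝ ψ X v (q - z) := by
  rw [le_sub_iff_add_le]
  refine ge_of_tendsto (tendsto_slope_fderivWithin hX hz.1 hq hψ) ?_
  filter_upwards [Ioc_mem_nhdsGT zero_lt_one] with τ hτ
  have minimal := hz.2 (hX.add_smul_sub_mem hz.1 hq ⟨hτ.1.le, hτ.2⟩)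
  simp only [Set.mem_ofPred_eq, bregman] at minimal
  rw [show v - (z + τ • (q - z)) = (v - z) - τ • (q - z) by abel,
    show z + τ • (q - z) - v = (z - v) + τ • (q - z) by abel, map_sub y (v - z), map_add, map_smul,
    map_smul, smul_eq_mul, smul_eq_mul] at minimal
  rw [le_inv_mul_iff₀ hτ.1]
  linarith

theorem three_point (hz : IsProx X ψ v y z) (hψ : IsRegularizer X ψ) (hq : q ∈ X) :
    bregman X ψ z v + bregman X ψ q z + y (q - z) ≤ bregman X ψ q v := by
  have := hz.apply_sub_le_fderivWithin_sub hψ.strongConvexOn.1 (hψ.differentiableOn z hz.1) hq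
  rw [bregman_three_point z v q]
  linarith

theorem norm_sub_le (hz : IsProx X ψ v y z) (hψ : IsRegularizer X ψ) (hv : v ∈ X) :
    ‖z - v‖ ≤ ‖y‖ := by
  have three_point := hz.three_point hψ hv
  have strong_zv := hψ.half_norm_sub_sq_le_bregman hz.1 hv
  have strong_vz := hψ.half_norm_sub_sq_le_bregman hv hz.1
  have dual := (le_abs_self _).trans (y.le_opNorm (z - v))
  rw [bregman_self, ← neg_sub z v, map_neg] at three_point
  rw [norm_sub_rev] at strong_vz
  by_contra! hlt
  nlinarith [norm_nonneg y, norm_nonneg (z - v)]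

theorem apply_sub_le (hz : IsProx X ψ v y z) (hψ : IsRegularizer X ψ) (hv : v ∈ X) (hq : q ∈ X) :
    y (q - v) ≤ bregman X ψ q v - bregman X ψ q z + 1 / 2 * ‖y‖ ^ 2 := by
  have three_point := hz.three_point hψ hq
  have strong := hψ.half_norm_sub_sq_le_bregman hz.1 hv
  have dual := (le_abs_self _).trans (y.le_opNorm (z - v))
  rw [← sub_add_sub_cancel q z v, map_add]
  nlinarith [sq_nonneg (‖y‖ - ‖z - v‖)]

theorem mul_apply_sub_le {a : ℝ} {g : StrongDual ℝ E} (hz : IsProx X ψ v (-(a • g)) z)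
    (hψ : IsRegularizer X ψ) (hv : v ∈ X) (hq : q ∈ X) :
    a * g (v - q) ≤ bregman X ψ q v - bregman X ψ q z + a * (a / 2 * ‖g‖ ^ 2) :=
  calc a * g (v - q) = (-(a • g)) (q - v) := by
        simp only [map_sub, neg_apply, smul_apply, smul_eq_mul]
        ring
    _ ≤ bregman X ψ q v - bregman X ψ q z + 1 / 2 * ‖-(a • g)‖ ^ 2 := hz.apply_sub_le hψ hv hq
    _ = _ := by
        rw [norm_neg, norm_smul, mul_pow, Real.norm_eq_abs, sq_abs]
        ring

theorem half_norm_sub_sq_le (hz : IsProx X ψ v y z) (hψ : IsRegularizer X ψ) (hq : q ∈ X) :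
    1 / 2 * ‖q - z‖ ^ 2 ≤ (y (v - q) + bregman X ψ q v) - (y (v - z) + bregman X ψ z v) := by
  have three_point := hz.three_point hψ hq
  have strong := hψ.half_norm_sub_sq_le_bregman hq hz.1
  rw [← sub_add_sub_cancel v q z, map_add]
  linarith

end IsProx

end Prox

section Descent

theorem sum_sub_div_le {A α : ℕ → ℝ} {M : ℝ} (hAM : ∀ t, A t ≤ M) (hα : Antitone α) (T : ℕ)
    (hT : 0 < α T) :
    ∑ t ∈ Finset.Icc 1 T, (A t - A (t + 1)) / α t ≤ (M - A (T + 1)) / α T := by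
  induction T with
  | zero => simpa using div_nonneg (sub_nonneg.2 (hAM 1)) hT.le
  | succ T ih =>
    rw [Finset.sum_Icc_succ_top (by omega)]
    calc _ ≤ (M - A (T + 1)) / α T + (A (T + 1) - A (T + 1 + 1)) / α (T + 1) :=
          add_le_add_left (ih (hT.trans_le (hα T.le_succ))) _
      _ ≤ (M - A (T + 1)) / α (T + 1) + (A (T + 1) - A (T + 1 + 1)) / α (T + 1) :=
          add_le_add_left
            (div_le_div_of_nonneg_left (sub_nonneg.2 (hAM _)) hT (hα T.le_succ)) _
      _ = _ := by rw [← add_div, sub_add_sub_cancel]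

variable {E : Type*} [NormedAddCommGroup E] [NormedSpace ℝ E] {X : Set E} {ψ : E → ℝ}
  {ι : Type*} [Fintype ι]

theorem sum_convexOn_averages_le [DecidableEq ι] {φ : E → ℝ} (hφ : ConvexOn ℝ X φ)
    {W : Matrix ι ι ℝ} (hW : W ∈ doublyStochastic ℝ ι) {y : ι → E} (hy : ∀ i, y i ∈ X) :
    ∑ i, φ (∑ j, W i j • y j) ≤ ∑ j, φ (y j) :=
  calc ∑ i, φ (∑ j, W i j • y j) ≤ ∑ i, ∑ j, W i j * φ (y j) :=
        Finset.sum_le_sum fun i _ => hφ.map_sum_le (fun _ _ => nonneg_of_mem_doublyStochastic hW)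
          (sum_row_of_mem_doublyStochastic hW i) fun j _ => hy j
    _ = ∑ j, φ (y j) := by
        rw [Finset.sum_comm]
        simp only [← Finset.sum_mul, sum_col_of_mem_doublyStochastic hW, one_mul]

theorem sum_apply_sub_le_of_isProx (hψ : IsRegularizer X ψ) {v z : ι → E} (hv : ∀ i, v i ∈ X)
    {a : ℝ} (ha : 0 < a) {g : ι → StrongDual ℝ E} (hz : ∀ i, IsProx X ψ (v i) (-(a • g i)) (z i))
    {q : E} (hq : q ∈ X) :
    ∑ i, g i (v i - q) ≤ (∑ i, bregman X ψ q (v i) - ∑ i, bregman X ψ q (z i)) / a +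
      ∑ i, a / 2 * ‖g i‖ ^ 2 := by
  have scaled : a * ∑ i, g i (v i - q) ≤ (∑ i, bregman X ψ q (v i) - ∑ i, bregman X ψ q (z i)) +
      a * ∑ i, a / 2 * ‖g i‖ ^ 2 := by
    rw [Finset.mul_sum, Finset.mul_sum, ← Finset.sum_sub_distrib, ← Finset.sum_add_distrib]
    exact Finset.sum_le_sum fun i _ => (hz i).mul_apply_sub_le hψ (hv i) hq
  rw [← le_div_iff₀' ha] at scaled
  refine scaled.trans_eq ?_
  field_simp

theorem sum_apply_sub_le_of_mirrorDescent [DecidableEq ι] (hψ : IsRegularizer X ψ)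
    {M : ℝ} (hM : ∀ p ∈ X, ∀ p' ∈ X, bregman X ψ p p' ≤ M) {W : ℕ → Matrix ι ι ℝ}
    (hW : ∀ t, W t ∈ doublyStochastic ℝ ι) {α : ℕ → ℝ} (hα : Antitone α) {y : ℕ → ι → E}
    (hy : ∀ t i, y t i ∈ X) {g : ℕ → ι → StrongDual ℝ E}
    (hprox : ∀ t i, IsProx X ψ (∑ j, W t i j • y t j) (-(α t • g t i)) (y (t + 1) i)) {q : E}
    (hq : q ∈ X) (hconv : ConvexOn ℝ X (bregman X ψ q)) {T : ℕ} (hT : 0 < α T) :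
    ∑ t ∈ Finset.Icc 1 T, ∑ i, g t i (∑ j, W t i j • y t j - q) ≤
      Fintype.card ι * M / α T + ∑ t ∈ Finset.Icc 1 T, ∑ i, α t / 2 * ‖g t i‖ ^ 2 := by
  have hv : ∀ t i, ∑ j, W t i j • y t j ∈ X := fun t i =>
    hψ.strongConvexOn.1.sum_mem (fun _ _ => nonneg_of_mem_doublyStochastic (hW t))
      (sum_row_of_mem_doublyStochastic (hW t) i) fun j _ => hy t j
  set A : ℕ → ℝ := fun t => ∑ i, bregman X ψ q (y t i)
  have A_nonneg : 0 ≤ A (T + 1) := Finset.sum_nonneg fun i _ =>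
    le_trans (by positivity) (hψ.half_norm_sub_sq_le_bregman hq (hy (T + 1) i))
  have A_le : ∀ t, A t ≤ Fintype.card ι * M := fun t =>
    (Finset.sum_le_card_nsmul _ _ M fun i _ => hM q hq _ (hy t i)).trans_eq
      (by rw [Finset.card_univ, nsmul_eq_mul])
  have step : ∀ t ∈ Finset.Icc 1 T, ∑ i, g t i (∑ j, W t i j • y t j - q) ≤
      (A t - A (t + 1)) / α t + ∑ i, α t / 2 * ‖g t i‖ ^ 2 := fun t ht => by
    have hαt : 0 < α t := hT.trans_le (hα (Finset.mem_Icc.1 ht).2)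
    refine (sum_apply_sub_le_of_isProx hψ (hv t) hαt (hprox t) hq).trans (add_le_add_left ?_ _)
    exact div_le_div_of_nonneg_right
      (sub_le_sub_right (sum_convexOn_averages_le hconv (hW t) (hy t)) _) hαt.le
  refine (Finset.sum_le_sum step).trans ?_
  rw [Finset.sum_add_distrib]
  refine add_le_add_left ((sum_sub_div_le A_le hα T hT).trans ?_) _
  exact div_le_div_of_nonneg_right (sub_le_self _ A_nonneg) hT.le

end Descent

section Measurability

variable {Ω : Type*} {m : MeasurableSpace Ω}

theorem stronglyMeasurable_comp_of_continuousOn {F β : Type*} [TopologicalSpace F]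
    [TopologicalSpace.PseudoMetrizableSpace F] [MeasurableSpace F] [BorelSpace F]
    [SecondCountableTopology F] [TopologicalSpace β] [TopologicalSpace.PseudoMetrizableSpace β]
    {K : Set F} {h : F → β} (hh : ContinuousOn h K) {v : Ω → F} (hv : Measurable v)
    (hvK : ∀ ω, v ω ∈ K) : StronglyMeasurable fun ω => h (v ω) :=
  (continuousOn_iff_continuous_domRestrict.1 hh).comp_stronglyMeasurable
    (hv.subtype_mk (h := hvK)).stronglyMeasurable

theorem integrable_comp_of_continuousOn {P : Measure Ω} [IsFiniteMeasure P] {F β : Type*}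
    [TopologicalSpace F] [TopologicalSpace.PseudoMetrizableSpace F] [MeasurableSpace F]
    [BorelSpace F] [SecondCountableTopology F] [NormedAddCommGroup β] {K : Set F}
    (hK : IsCompact K) {h : F → β} (hh : ContinuousOn h K) {v : Ω → F} (hv : Measurable v)
    (hvK : ∀ ω, v ω ∈ K) : Integrable (fun ω => h (v ω)) P := by
  obtain ⟨C, hC⟩ := hK.exists_bound_of_continuousOn hh
  exact Integrable.of_bound
    (stronglyMeasurable_comp_of_continuousOn hh hv hvK).aestronglyMeasurable C
    (Eventually.of_forall fun ω => hC _ (hvK ω))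

theorem exists_mem_lt_add_of_subset_closure {F : Type*} [TopologicalSpace F] {X S D : Set F}
    {h : F → ℝ} (hh : ContinuousOn h X) (hS : S ⊆ X) (hD : D ⊆ S) (hSD : S ⊆ closure D) {y : F}
    (hy : y ∈ S) {ε : ℝ} (hε : 0 < ε) : ∃ p ∈ D, h p < h y + ε := by
  have near := ((hh y (hS hy)).mono (hD.trans hS)).eventually
    (gt_mem_nhds (lt_add_of_pos_right (h y) hε))
  have := mem_closure_iff_nhdsWithin_neBot.1 (hSD hy)
  obtain ⟨p, hp, hpD⟩ := (near.and self_mem_nhdsWithin).exists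
  exact ⟨p, hpD, hp⟩

variable {E : Type*} [NormedAddCommGroup E]

theorem mem_iff_forall_exists_le_of_quadratic_growth {X C D D' : Set E} (hC : IsClosed C)
    (hD : D ⊆ X) (hXD : X ⊆ closure D) (hD' : D' ⊆ X ∩ C) (hXD' : X ∩ C ⊆ closure D') {h : E → ℝ}
    (hh : ContinuousOn h X) {z : E} (hz : z ∈ X)
    (growth : ∀ q ∈ X, 1 / 2 * ‖q - z‖ ^ 2 ≤ h q - h z) :
    z ∈ C ↔ ∀ q ∈ D, ∀ k : ℕ, ∃ p ∈ D', h p ≤ h q + 1 / ((k : ℝ) + 1) := by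
  constructor
  · intro hzC q hq k
    obtain ⟨p, hp, hlt⟩ := exists_mem_lt_add_of_subset_closure hh Set.inter_subset_left hD' hXD'
      ⟨hz, hzC⟩ (Nat.one_div_pos_of_nat (α := ℝ) (n := k))
    have hzq : h z ≤ h q := sub_nonneg.1 (le_trans (by positivity) (growth q (hD hq)))
    exact ⟨p, hp, hlt.le.trans (add_le_add_left hzq _)⟩
  · intro hinf
    rw [← hC.closure_eq, Metric.mem_closure_iff]
    intro ε hε
    obtain ⟨q, hq, hlt⟩ :=
      exists_mem_lt_add_of_subset_closure hh le_rfl hD hXD hz (show 0 < ε ^ 2 / 4 by positivity)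
    obtain ⟨k, hk⟩ := exists_nat_one_div_lt (show 0 < ε ^ 2 / 4 by positivity)
    obtain ⟨p, hp, hle⟩ := hinf q hq k
    refine ⟨p, (hD' hp).2, ?_⟩
    rw [dist_comm, dist_eq_norm]
    exact lt_of_pow_lt_pow_left₀ 2 hε.le (by linarith [growth p (hD' hp).1])

-- The minimizer lies in a closed set `C` iff the infima over countable dense subsets of `X` and of
-- `X ∩ C` agree, which is a countable condition.
theorem measurable_of_quadratic_growth [MeasurableSpace E] [BorelSpace E]
    [SecondCountableTopology E] {X : Set E} {h : Ω → E → ℝ}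
    (hmeas : ∀ q ∈ X, Measurable fun ω => h ω q) (hcont : ∀ ω, ContinuousOn (h ω) X) {z : Ω → E}
    (hz : ∀ ω, z ω ∈ X) (growth : ∀ ω, ∀ q ∈ X, 1 / 2 * ‖q - z ω‖ ^ 2 ≤ h ω q - h ω (z ω)) :
    Measurable z := by
  refine measurable_of_isClosed fun C hC => ?_
  obtain ⟨D, hD, D_countable, hXD⟩ :=
    (TopologicalSpace.IsSeparable.of_separableSpace X).exists_countable_dense_subset
  obtain ⟨D', hD', D'_countable, hXD'⟩ :=
    (TopologicalSpace.IsSeparable.of_separableSpace (X ∩ C)).exists_countable_dense_subset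
  have preimage_eq : z ⁻¹' C =
      ⋂ q ∈ D, ⋂ k : ℕ, ⋃ p ∈ D', {ω | h ω p ≤ h ω q + 1 / ((k : ℝ) + 1)} := by
    ext ω
    simpa only [Set.mem_preimage, Set.mem_iInter, Set.mem_iUnion, Set.mem_ofPred_eq, exists_prop]
      using mem_iff_forall_exists_le_of_quadratic_growth hC hD hXD hD' hXD' (hcont ω) (hz ω)
        (growth ω)
  rw [preimage_eq]
  exact MeasurableSet.biInter D_countable fun q hq => MeasurableSet.iInter fun k =>
    MeasurableSet.biUnion D'_countable fun p hp =>
      measurableSet_le (hmeas p (hD' hp).1) ((hmeas q (hD hq)).add_const _)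

variable [NormedSpace ℝ E] [MeasurableSpace E] [BorelSpace E] [SecondCountableTopology E]
  {X : Set E} {ψ : E → ℝ}

theorem measurable_bregman_right (hX : Convex ℝ X) (hψ : DifferentiableOn ℝ ψ X) {q : E}
    (hq : q ∈ X) {v : Ω → E} (hv : Measurable v) (hvX : ∀ ω, v ω ∈ X) :
    Measurable fun ω => bregman X ψ q (v ω) := by
  have ψ_comp : ∀ {u : Ω → E}, Measurable u → (∀ ω, u ω ∈ X) → Measurable fun ω => ψ (u ω) :=
    fun hu huX => (stronglyMeasurable_comp_of_continuousOn hψ.continuousOn hu huX).measurable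
  obtain ⟨τ, -, hτ, hτ0⟩ := exists_seq_strictAnti_tendsto' (zero_lt_one (α := ℝ))
  have hτ_right : Tendsto τ atTop (𝓝[>] 0) :=
    tendsto_nhdsWithin_iff.2 ⟨hτ0, Eventually.of_forall fun k => (hτ k).1⟩
  have slope_measurable : ∀ k, Measurable fun ω =>
      (τ k)⁻¹ * (ψ (v ω + τ k • (q - v ω)) - ψ (v ω)) := fun k =>
    measurable_const.mul ((ψ_comp (hv.add ((measurable_const.sub hv).const_smul _)) fun ω =>
      hX.add_smul_sub_mem (hvX ω) hq ⟨(hτ k).1.le, (hτ k).2.le⟩).sub (ψ_comp hv hvX))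
  have fderiv_measurable : Measurable fun ω => fderivWithin ℝ ψ X (v ω) (q - v ω) :=
    measurable_of_tendsto_metrizable slope_measurable (tendsto_pi_nhds.2 fun ω =>
      (tendsto_slope_fderivWithin hX (hvX ω) hq (hψ _ (hvX ω))).comp hτ_right)
  exact (measurable_const.sub (ψ_comp hv hvX)).sub fderiv_measurable

theorem IsProx.measurable (hψ : IsRegularizer X ψ) {v z : Ω → E} {y : Ω → StrongDual ℝ E}
    (hz : ∀ ω, IsProx X ψ (v ω) (y ω) (z ω)) (hv : Measurable v) (hvX : ∀ ω, v ω ∈ X)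
    (hy : StronglyMeasurable y) : Measurable z := by
  refine measurable_of_quadratic_growth (h := fun ω q => y ω (v ω - q) + bregman X ψ q (v ω))
    (fun q hq => ?_) (fun ω => ?_) (fun ω => (hz ω).1)
    fun ω q hq => (hz ω).half_norm_sub_sq_le hψ hq
  · exact (isBoundedBilinearMap_apply.continuous.comp_stronglyMeasurable
      (hy.prodMk (hv.sub_const q).stronglyMeasurable)).measurable.add
      (measurable_bregman_right hψ.strongConvexOn.1 hψ.differentiableOn hq hv hvX)
  · have := hψ.differentiableOn.continuousOn
    unfold bregman
    fun_prop

end Measurability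

section Moments

variable {Ω : Type*} {mΩ : MeasurableSpace Ω} {P : Measure Ω}

theorem integral_norm_le_of_integral_norm_sq_le [IsProbabilityMeasure P] {F : Type*}
    [NormedAddCommGroup F] {h : Ω → F} (hh : AEStronglyMeasurable h P)
    (hsq : Integrable (fun ω => ‖h ω‖ ^ 2) P) {c : ℝ} (hc : 0 ≤ c)
    (hle : ∫ ω, ‖h ω‖ ^ 2 ∂P ≤ c ^ 2) : ∫ ω, ‖h ω‖ ∂P ≤ c := by
  have integrable_norm : Integrable (fun ω => ‖h ω‖) P :=
    (((memLp_two_iff_integrable_sq_norm hh).2 hsq).integrable one_le_two).norm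
  have jensen : (∫ ω, ‖h ω‖ ∂P) ^ 2 ≤ ∫ ω, ‖h ω‖ ^ 2 ∂P :=
    (even_two.convexOn_pow (𝕜 := ℝ)).map_integral_le (continuous_pow 2).continuousOn isClosed_univ
      (Eventually.of_forall fun _ => Set.mem_univ _) integrable_norm hsq
  exact le_of_sq_le_sq (jensen.trans hle) hc

theorem integrable_norm_sq_of_norm_sub_sq [IsFiniteMeasure P] {F : Type*} [NormedAddCommGroup F]
    {g h : Ω → F} {L : ℝ} (hg : AEStronglyMeasurable g P) (hgL : ∀ ω, ‖g ω‖ ≤ L)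
    (hh : AEStronglyMeasurable h P) (hsq : Integrable (fun ω => ‖g ω - h ω‖ ^ 2) P) :
    Integrable (fun ω => ‖h ω‖ ^ 2) P := by
  have memLp_sub := (memLp_two_iff_integrable_sq_norm (hg.sub hh)).2 hsq
  have memLp_g : MemLp g 2 P := MemLp.of_bound hg L (Eventually.of_forall hgL)
  have := (memLp_g.sub memLp_sub).integrable_norm_pow two_ne_zero
  simpa only [Pi.sub_apply, sub_sub_cancel] using this

theorem integral_norm_sq_le_add_sq [IsProbabilityMeasure P] {F : Type*} [NormedAddCommGroup F]
    {g h : Ω → F} {L ν : ℝ} (hν : 0 ≤ ν) (hg : AEStronglyMeasurable g P) (hgL : ∀ ω, ‖g ω‖ ≤ L)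
    (hh : AEStronglyMeasurable h P) (hsq : Integrable (fun ω => ‖g ω - h ω‖ ^ 2) P)
    (hvar : ∫ ω, ‖g ω - h ω‖ ^ 2 ∂P ≤ ν ^ 2) : ∫ ω, ‖h ω‖ ^ 2 ∂P ≤ (L + ν) ^ 2 := by
  obtain ⟨ω₀⟩ : Nonempty Ω := nonempty_of_isProbabilityMeasure P
  have hL : 0 ≤ L := (norm_nonneg _).trans (hgL ω₀)
  have norm_sub_integrable : Integrable (fun ω => ‖g ω - h ω‖) P :=
    (((memLp_two_iff_integrable_sq_norm (hg.sub hh)).2 hsq).integrable one_le_two).norm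
  have integral_norm_sub_le : ∫ ω, ‖g ω - h ω‖ ∂P ≤ ν :=
    integral_norm_le_of_integral_norm_sq_le (hg.sub hh) hsq hν hvar
  have linear : Integrable (fun ω => L ^ 2 + 2 * L * ‖g ω - h ω‖) P :=
    (integrable_const _).add (norm_sub_integrable.const_mul _)
  have pointwise : ∀ ω, ‖h ω‖ ^ 2 ≤ L ^ 2 + 2 * L * ‖g ω - h ω‖ + ‖g ω - h ω‖ ^ 2 := fun ω => by
    have triangle : ‖h ω‖ ≤ L + ‖g ω - h ω‖ :=
      (norm_le_norm_add_norm_sub (g ω) (h ω)).trans (add_le_add_left (hgL ω) _)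
    exact (pow_le_pow_left₀ (norm_nonneg _) triangle 2).trans_eq (by ring)
  calc ∫ ω, ‖h ω‖ ^ 2 ∂P
      ≤ ∫ ω, (L ^ 2 + 2 * L * ‖g ω - h ω‖ + ‖g ω - h ω‖ ^ 2) ∂P :=
        integral_mono (integrable_norm_sq_of_norm_sub_sq hg hgL hh hsq) (linear.add hsq) pointwise
    _ = L ^ 2 + 2 * L * ∫ ω, ‖g ω - h ω‖ ∂P + ∫ ω, ‖g ω - h ω‖ ^ 2 ∂P := by
        rw [integral_add linear hsq,
          integral_add (integrable_const _) (norm_sub_integrable.const_mul _), integral_const_mul,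
          integral_const, probReal_univ, one_smul]
    _ ≤ L ^ 2 + 2 * L * ν + ν ^ 2 := by gcongr
    _ = (L + ν) ^ 2 := by ring

variable {F : Type*} [NormedAddCommGroup F] [NormedSpace ℝ F]

theorem integrable_apply_of_norm_le {g : Ω → StrongDual ℝ F} (hg : Integrable g P) {w : Ω → F}
    (hw : AEStronglyMeasurable w P) {C : ℝ} (hC : ∀ ω, ‖w ω‖ ≤ C) :
    Integrable (fun ω => g ω (w ω)) P :=
  (hg.norm.mul_const C).mono'
    (isBoundedBilinearMap_apply.continuous.comp_aestronglyMeasurable (hg.1.prodMk hw))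
    (Eventually.of_forall fun ω => (g ω).le_opNorm_of_le (hC ω))

theorem integral_apply_eq_of_condExp_ae_eq [IsFiniteMeasure P] {m : MeasurableSpace Ω} (hm : m ≤ mΩ)
    {ghat g : Ω → StrongDual ℝ F} (hghat : Integrable ghat P) (hcond : P[ghat | m] =ᵐ[P] g)
    {w : Ω → F} (hw : StronglyMeasurable[m] w) {C : ℝ} (hC : ∀ ω, ‖w ω‖ ≤ C) :
    ∫ ω, ghat ω (w ω) ∂P = ∫ ω, g ω (w ω) ∂P := by
  have condExp_apply := condExp_bilin_of_stronglyMeasurable_right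
    (ContinuousLinearMap.id ℝ (StrongDual ℝ F)) hw
    (integrable_apply_of_norm_le hghat (hw.mono hm).aestronglyMeasurable hC) hghat
  rw [← integral_condExp hm]
  refine integral_congr_ae ?_
  filter_upwards [condExp_apply, hcond] with ω happly hmean
  rw [← hmean]
  exact happly

end Moments

namespace UnbiasedBoundedVariance

variable {E : Fin 2 → Type*} [∀ l, NormedAddCommGroup (E l)] [∀ l, NormedSpace ℝ (E l)]
  {Ω : Type*} {mΩ : MeasurableSpace Ω} {P : Measure Ω} {n : Fin 2 → ℕ}
  {ℱ : Filtration ℕ mΩ} {ghat g : ∀ l, Fin (n l) → ℕ → Ω → StrongDual ℝ (E l)} {ν : Fin 2 → ℝ}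
  {L : ℝ}

theorem integrable_mean (h : UnbiasedBoundedVariance P ℱ ghat g ν) (l : Fin 2) (i : Fin (n l))
    (t : ℕ) : Integrable (g l i t) P :=
  integrable_condExp.congr (h.unbiased l i t)

variable [IsProbabilityMeasure P]

theorem integral_norm_sub_sq_le (h : UnbiasedBoundedVariance P ℱ ghat g ν) (l : Fin 2)
    (i : Fin (n l)) (t : ℕ) : ∫ ω, ‖g l i t ω - ghat l i t ω‖ ^ 2 ∂P ≤ ν l ^ 2 := by
  rw [← integral_condExp (ℱ.le t)]
  refine (integral_mono_ae integrable_condExp (integrable_const _)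
    (h.variance_le l i t)).trans_eq ?_
  rw [integral_const, probReal_univ, one_smul]

theorem integrable_norm_sq (h : UnbiasedBoundedVariance P ℱ ghat g ν)
    (hL : ∀ l i t ω, ‖g l i t ω‖ ≤ L) (l : Fin 2) (i : Fin (n l)) (t : ℕ) :
    Integrable (fun ω => ‖ghat l i t ω‖ ^ 2) P :=
  integrable_norm_sq_of_norm_sub_sq (h.integrable_mean l i t).1 (hL l i t)
    (h.integrable l i t).1 (h.integrable_sq l i t)

theorem integral_norm_sq_le (h : UnbiasedBoundedVariance P ℱ ghat g ν)
    (hL : ∀ l i t ω, ‖g l i t ω‖ ≤ L) (hν : ∀ l, 0 ≤ ν l) (l : Fin 2) (i : Fin (n l)) (t : ℕ) :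
    ∫ ω, ‖ghat l i t ω‖ ^ 2 ∂P ≤ (L + ν l) ^ 2 :=
  integral_norm_sq_le_add_sq (hν l) (h.integrable_mean l i t).1 (hL l i t)
    (h.integrable l i t).1 (h.integrable_sq l i t) (h.integral_norm_sub_sq_le l i t)

theorem integral_norm_le (h : UnbiasedBoundedVariance P ℱ ghat g ν) (hL0 : 0 ≤ L)
    (hL : ∀ l i t ω, ‖g l i t ω‖ ≤ L) (hν : ∀ l, 0 ≤ ν l) (l : Fin 2) (i : Fin (n l)) (t : ℕ) :
    ∫ ω, ‖ghat l i t ω‖ ∂P ≤ L + ν l :=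
  integral_norm_le_of_integral_norm_sq_le (h.integrable l i t).1 (h.integrable_norm_sq hL l i t)
    (add_nonneg hL0 (hν l)) (h.integral_norm_sq_le hL hν l i t)

end UnbiasedBoundedVariance

theorem update_mem_of_mem {ι : Type*} [DecidableEq ι] {F : ι → Type*} {X : ∀ l, Set (F l)}
    {z : ∀ k, F k} (hz : ∀ k, z k ∈ X k) {l : ι} {y : F l} (hy : y ∈ X l) (k : ι) :
    Function.update z l y k ∈ X k :=
  (Function.forall_update_iff z fun k y => y ∈ X k).2 ⟨hy, fun k _ => hz k⟩ k

section Game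

variable {E : Fin 2 → Type*} [∀ l, NormedAddCommGroup (E l)] {n : Fin 2 → ℕ} {O : ∀ l, Set (E l)}
  {f : ∀ l, Fin (n l) → (∀ k, E k) → ℝ} {L : ℝ}

theorem LipschitzCosts.apply_update_sub_le (h : LipschitzCosts O f L) (l : Fin 2) (i : Fin (n l))
    {z : ∀ k, E k} (hz : ∀ k, z k ∈ O k) {y : E l} (hy : y ∈ O l) :
    f l i (Function.update z l y) - f l i z ≤ L * ‖y - z l‖ := by
  have lipschitz := (le_abs_self _).trans (h l i _ z (update_mem_of_mem hz hy) hz)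
  fin_cases l <;> simpa using lipschitz

theorem LipschitzCosts.continuousOn (h : LipschitzCosts O f L) (hL : 0 ≤ L) (l : Fin 2)
    (i : Fin (n l)) : ContinuousOn (f l i) (Set.univ.pi O) := by
  refine (LipschitzOnWith.of_dist_le_mul (K := (2 * L).toNNReal) fun z hz z' hz' => ?_).continuousOn
  rw [Real.dist_eq, Real.coe_toNNReal _ (by positivity), dist_eq_norm]
  have coordinate : ∀ k, ‖z k - z' k‖ ≤ ‖z - z'‖ := fun k => norm_le_pi_norm (z - z') k
  calc |f l i z - f l i z'| ≤ L * (‖z 0 - z' 0‖ + ‖z 1 - z' 1‖) :=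
        h l i z z' (fun k => hz k trivial) fun k => hz' k trivial
    _ ≤ L * (‖z - z'‖ + ‖z - z'‖) := by gcongr <;> exact coordinate _
    _ = 2 * L * ‖z - z'‖ := by ring

theorem LipschitzCosts.continuousOn_gameCost (h : LipschitzCosts O f L) (hL : 0 ≤ L) :
    ContinuousOn (gameCost f) (Set.univ.pi O) :=
  continuousOn_const.mul (continuousOn_finsetSum _ fun i _ => h.continuousOn hL 0 i)

variable [∀ l, NormedSpace ℝ (E l)]

theorem LipschitzCosts.norm_le_of_mem_partialSubdiff (h : LipschitzCosts O f L)
    (hO : ∀ l, IsOpen (O l)) (hL : 0 ≤ L) (l : Fin 2) (i : Fin (n l)) {z : ∀ k, E k}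
    (hz : ∀ k, z k ∈ O k) {g : StrongDual ℝ (E l)} (hg : g ∈ partialSubdiff O l (f l i) z) :
    ‖g‖ ≤ L := by
  obtain ⟨ε, hε, hball⟩ := Metric.isOpen_iff.1 (hO l) (z l) (hz l)
  have apply_le : ∀ w : E l, ‖w‖ < ε → g w ≤ L * ‖w‖ := fun w hw => by
    have hmem : z l + w ∈ O l := hball (by simpa using hw)
    have subgradient := hg _ hmem
    have lipschitz := h.apply_update_sub_le l i hz hmem
    rw [add_sub_cancel_left] at subgradient lipschitz
    linarith
  refine ContinuousLinearMap.opNorm_le_of_ball hε hL fun w hw => ?_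
  rw [mem_ball_zero_iff] at hw
  have apply_neg_le := apply_le (-w) (by rwa [norm_neg])
  rw [norm_neg, map_neg] at apply_neg_le
  exact abs_le.2 ⟨neg_le.1 apply_neg_le, apply_le w hw⟩

theorem LipschitzCosts.sub_le_apply_add (h : LipschitzCosts O f L) (j : Fin (n 0))
    {z z' : ∀ k, E k} (hz : ∀ k, z k ∈ O k) (hz' : ∀ k, z' k ∈ O k) {g : StrongDual ℝ (E 0)}
    (hg : g ∈ partialSubdiff O 0 (f 0 j) z') {p q : E 0} (hp : p ∈ O 0) (hq : q ∈ O 0) :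
    f 0 j (Function.update z 0 p) - f 0 j (Function.update z 0 q) ≤
      g (z' 0 - q) + L * (‖p - z' 0‖ + 2 * ‖z 1 - z' 1‖) := by
  have subgradient := hg q hq
  have at_p := (le_abs_self _).trans (h 0 j _ z' (update_mem_of_mem hz hp) hz')
  have at_q := (le_abs_self _).trans
    (h 0 j _ _ (update_mem_of_mem hz' hq) (update_mem_of_mem hz hq))
  rw [← neg_sub (z' 0) q, map_neg] at subgradient
  simp only [Function.update_self, ne_eq, one_ne_zero, not_false_eq_true, Function.update_of_ne,
    sub_self, norm_zero, zero_add] at at_p at_q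
  rw [norm_sub_rev (z' 1)] at at_q
  linarith

theorem gameCost_sub_le (h : LipschitzCosts O f L) (hL : 0 ≤ L) {z : Fin (n 0) → ∀ k, E k}
    (hz : ∀ j k, z j k ∈ O k) {g : Fin (n 0) → StrongDual ℝ (E 0)}
    (hg : ∀ j, g j ∈ partialSubdiff O 0 (f 0 j) (z j)) (i : Fin (n 0)) {p q : E 0} (hp : p ∈ O 0)
    (hq : q ∈ O 0) (c : ∀ k, E k) :
    gameCost f (Function.update (z i) 0 p) - gameCost f (Function.update (z i) 0 q) ≤
      1 / (n 0 : ℝ) * ∑ j, (g j (z j 0 - q) + L * (‖p - c 0‖ + ‖z j 0 - c 0‖ +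
        2 * (‖z i 1 - c 1‖ + ‖z j 1 - c 1‖))) := by
  unfold gameCost
  rw [← mul_sub, ← Finset.sum_sub_distrib]
  refine mul_le_mul_of_nonneg_left (Finset.sum_le_sum fun j _ => ?_) (by positivity)
  refine (h.sub_le_apply_add j (hz i) (hz j) (hg j) hp hq).trans ?_
  have via_center : ∀ {k} (y y' : E k), ‖y - y'‖ ≤ ‖y - c k‖ + ‖y' - c k‖ := fun y y' => by
    rw [norm_sub_rev y']
    exact norm_sub_le_norm_sub_add_norm_sub _ _ _
  gcongr <;> exact via_center _ _

end Game

section StochasticWeights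

variable {ι F : Type*} [Fintype ι] [NormedAddCommGroup F] [NormedSpace ℝ F] {w : ι → ℝ}

theorem norm_sum_smul_sub_le (hw : w ∈ stdSimplex ℝ ι) (y : ι → F) (c : F) :
    ‖∑ j, w j • y j - c‖ ≤ ∑ j, w j * ‖y j - c‖ := by
  have recenter : ∑ j, w j • y j - c = ∑ j, w j • (y j - c) := by
    simp only [smul_sub, Finset.sum_sub_distrib, ← Finset.sum_smul, hw.2, one_smul]
  rw [recenter]
  refine (norm_sum_le _ _).trans_eq ?_
  simp only [norm_smul, Real.norm_of_nonneg (hw.1 _)]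

theorem integral_norm_sum_smul_sub_le {Ω : Type*} [MeasurableSpace Ω] {P : Measure Ω}
    (hw : w ∈ stdSimplex ℝ ι) {y : ι → Ω → F} (hy : ∀ j, Integrable (y j) P) {c : Ω → F}
    (hc : Integrable c P) {H : ℝ} (hH : ∀ j, ∫ ω, ‖y j ω - c ω‖ ∂P ≤ H) :
    ∫ ω, ‖∑ j, w j • y j ω - c ω‖ ∂P ≤ H := by
  have integrable_term : ∀ j, Integrable (fun ω => w j * ‖y j ω - c ω‖) P := fun j =>
    ((hy j).sub hc).norm.const_mul _
  calc ∫ ω, ‖∑ j, w j • y j ω - c ω‖ ∂P ≤ ∫ ω, ∑ j, w j * ‖y j ω - c ω‖ ∂P :=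
        integral_mono ((integrable_finsetSum _ fun j _ => (hy j).smul (w j)).sub hc).norm
          (integrable_finsetSum _ fun j _ => integrable_term j) fun ω =>
          norm_sum_smul_sub_le hw _ _
    _ = ∑ j, w j * ∫ ω, ‖y j ω - c ω‖ ∂P := by
        rw [integral_finsetSum _ fun j _ => integrable_term j]
        simp only [integral_const_mul]
    _ ≤ ∑ j, w j * H := Finset.sum_le_sum fun j _ => mul_le_mul_of_nonneg_left (hH j) (hw.1 j)
    _ = H := by rw [← Finset.sum_mul, hw.2, one_mul]

end StochasticWeights

theorem pseudoRegret_le_of_forall {E : Fin 2 → Type*} {Ω : Type*} [MeasurableSpace Ω]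
    {P : Measure Ω} {X : ∀ l, Set (E l)} {U : (∀ k, E k) → ℝ} {xi : ℕ → Ω → E 0}
    {z : ℕ → Ω → ∀ k, E k} {T : ℕ} {C : ℝ} (hX : (X 0).Nonempty)
    (hxi : ∀ t, Integrable (fun ω => U (Function.update (z t ω) 0 (xi t ω))) P)
    (hz : ∀ q ∈ X 0, ∀ t, Integrable (fun ω => U (Function.update (z t ω) 0 q)) P)
    (hC : ∀ q ∈ X 0, ∑ t ∈ Finset.Icc 1 T,
      ∫ ω, (U (Function.update (z t ω) 0 (xi t ω)) - U (Function.update (z t ω) 0 q)) ∂P ≤ C) :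
    pseudoRegret P X U xi z T ≤ C := by
  refine sub_le_comm.1 (le_csInf (hX.image _) ?_)
  rintro _ ⟨q, hq, rfl⟩
  refine sub_le_comm.1 ((le_of_eq ?_).trans (hC q hq))
  beta_reduce
  rw [integral_finsetSum _ fun t _ => hxi t, integral_finsetSum _ fun t _ => hz q hq t,
    ← Finset.sum_sub_distrib]
  exact Finset.sum_congr rfl fun t _ => (integral_sub (hxi t) (hz q hq t)).symm

/-- Distributed stochastic mirror descent on compact sets `X l` with respect to a filtration `ℱ`:
the states `x` and the stochastic gradients `ghat`, of arbitrary origin, are only required to be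
adapted, `ghat` with a delay of one step. Row `i` of `W l k t` holds the weights that agent `i` of
network `l` gives to the agents of network `k`. -/
structure IsStochasticMirrorDescent {E : Fin 2 → Type*} [∀ l, NormedAddCommGroup (E l)]
    [∀ l, NormedSpace ℝ (E l)] [∀ l, MeasurableSpace (E l)] {Ω : Type*} {mΩ : MeasurableSpace Ω}
    {n : Fin 2 → ℕ} (X : ∀ l, Set (E l)) (ψ : ∀ l, E l → ℝ)
    (W : ∀ l k : Fin 2, ℕ → Matrix (Fin (n l)) (Fin (n k)) ℝ) (α : ℕ → ℝ) (ℱ : Filtration ℕ mΩ)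
    (x : ∀ l, Fin (n l) → ℕ → Ω → E l) (ghat : ∀ l, Fin (n l) → ℕ → Ω → StrongDual ℝ (E l)) :
    Prop where
  isCompact : ∀ l, IsCompact (X l)
  isRegularizer : ∀ l, IsRegularizer (X l) (ψ l)
  weights_mem : ∀ l k t i, W l k t i ∈ stdSimplex ℝ (Fin (n k))
  stepSize_nonneg : ∀ t, 0 ≤ α t
  init_mem : ∀ l i ω, x l i 0 ω ∈ X l
  init_measurable : ∀ l i, Measurable[ℱ 0] (x l i 0)
  gradient_measurable : ∀ l i t, StronglyMeasurable[ℱ (t + 1)] (ghat l i t)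
  update : ∀ l i t ω, IsProx (X l) (ψ l) (averages W x l i t ω l) (-(α t • ghat l i t ω))
    (x l i (t + 1) ω)

theorem measurable_averages {E : Fin 2 → Type*} [∀ l, NormedAddCommGroup (E l)]
    [∀ l, NormedSpace ℝ (E l)] [∀ l, MeasurableSpace (E l)] [∀ l, BorelSpace (E l)]
    [∀ l, SecondCountableTopology (E l)] {Ω : Type*} {m : MeasurableSpace Ω} {n : Fin 2 → ℕ}
    {W : ∀ l k : Fin 2, ℕ → Matrix (Fin (n l)) (Fin (n k)) ℝ}
    {x : ∀ l, Fin (n l) → ℕ → Ω → E l} {t : ℕ} (hx : ∀ l i, Measurable (x l i t)) (l : Fin 2)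
    (i : Fin (n l)) : Measurable (averages W x l i t) :=
  measurable_pi_iff.2 fun k => Finset.measurable_fun_sum _ fun j _ => (hx k j).const_smul _

namespace IsStochasticMirrorDescent

variable {E : Fin 2 → Type*} [∀ l, NormedAddCommGroup (E l)] [∀ l, NormedSpace ℝ (E l)]
  [∀ l, MeasurableSpace (E l)] {Ω : Type*} {mΩ : MeasurableSpace Ω} {n : Fin 2 → ℕ}
  {X : ∀ l, Set (E l)} {ψ : ∀ l, E l → ℝ}
  {W : ∀ l k : Fin 2, ℕ → Matrix (Fin (n l)) (Fin (n k)) ℝ} {α : ℕ → ℝ} {ℱ : Filtration ℕ mΩ}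
  {x : ∀ l, Fin (n l) → ℕ → Ω → E l} {ghat : ∀ l, Fin (n l) → ℕ → Ω → StrongDual ℝ (E l)}

theorem state_mem (h : IsStochasticMirrorDescent X ψ W α ℱ x ghat) (l : Fin 2) (i : Fin (n l))
    (t : ℕ) (ω : Ω) : x l i t ω ∈ X l := by
  cases t with
  | zero => exact h.init_mem l i ω
  | succ t => exact (h.update l i t ω).1

theorem averages_mem (h : IsStochasticMirrorDescent X ψ W α ℱ x ghat) (l : Fin 2) (i : Fin (n l))
    (t : ℕ) (ω : Ω) (k : Fin 2) : averages W x l i t ω k ∈ X k :=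
  (h.isRegularizer k).strongConvexOn.1.sum_mem (fun j _ => (h.weights_mem l k t i).1 j)
    (h.weights_mem l k t i).2 fun j _ => h.state_mem k j t ω

theorem norm_state_sub_le (h : IsStochasticMirrorDescent X ψ W α ℱ x ghat) (l : Fin 2)
    (i : Fin (n l)) (t : ℕ) (ω : Ω) :
    ‖x l i (t + 1) ω - averages W x l i t ω l‖ ≤ α t * ‖ghat l i t ω‖ := by
  have := (h.update l i t ω).norm_sub_le (h.isRegularizer l) (h.averages_mem l i t ω l)
  rwa [norm_neg, norm_smul, Real.norm_of_nonneg (h.stepSize_nonneg t)] at this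

theorem exists_norm_averages_sub_le (h : IsStochasticMirrorDescent X ψ W α ℱ x ghat) (l : Fin 2)
    (q : E l) : ∃ C, ∀ i t ω, ‖averages W x l i t ω l - q‖ ≤ C := by
  obtain ⟨C, hC⟩ := (h.isCompact l).exists_bound_of_continuousOn (f := fun y => y - q) (by fun_prop)
  exact ⟨C, fun i t ω => hC _ (h.averages_mem l i t ω l)⟩

variable [∀ l, BorelSpace (E l)] [∀ l, SecondCountableTopology (E l)]

theorem state_measurable (h : IsStochasticMirrorDescent X ψ W α ℱ x ghat) (t : ℕ) (l : Fin 2)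
    (i : Fin (n l)) : Measurable[ℱ t] (x l i t) := by
  induction t generalizing l i with
  | zero => exact h.init_measurable l i
  | succ t ih =>
    have previous : ∀ l i, Measurable[ℱ (t + 1)] (x l i t) := fun l i =>
      (ih l i).mono (ℱ.mono t.le_succ) le_rfl
    exact IsProx.measurable (m := ℱ (t + 1)) (h.isRegularizer l) (h.update l i t)
      ((measurable_pi_apply l).comp (measurable_averages (m := ℱ (t + 1)) previous l i))
      (fun ω => h.averages_mem l i t ω l)
      ((h.gradient_measurable l i t).const_smul (α t)).neg

theorem averages_measurable (h : IsStochasticMirrorDescent X ψ W α ℱ x ghat) (t : ℕ) (l : Fin 2)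
    (i : Fin (n l)) : Measurable[ℱ t] (averages W x l i t) :=
  measurable_averages (m := ℱ t) (h.state_measurable t) l i

variable {P : Measure Ω}

theorem integrable_state [IsFiniteMeasure P] (h : IsStochasticMirrorDescent X ψ W α ℱ x ghat)
    (l : Fin 2) (i : Fin (n l)) (t : ℕ) : Integrable (x l i t) P :=
  integrable_comp_of_continuousOn (h.isCompact l) continuousOn_id
    ((h.state_measurable t l i).mono (ℱ.le t) le_rfl) (h.state_mem l i t)

theorem integrable_averages [IsFiniteMeasure P] (h : IsStochasticMirrorDescent X ψ W α ℱ x ghat)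
    (l : Fin 2) (i : Fin (n l)) (t : ℕ) (k : Fin 2) :
    Integrable (fun ω => averages W x l i t ω k) P :=
  integrable_finsetSum _ fun j _ => (h.integrable_state k j t).smul _

theorem integrable_networkMean [IsFiniteMeasure P] (h : IsStochasticMirrorDescent X ψ W α ℱ x ghat)
    (l : Fin 2) (t : ℕ) : Integrable (fun ω => networkMean fun j => x l j t ω) P :=
  (integrable_finsetSum _ fun j _ => h.integrable_state l j t).smul _

theorem integrable_update_averages [IsFiniteMeasure P]
    (h : IsStochasticMirrorDescent X ψ W α ℱ x ghat) {U : (∀ k, E k) → ℝ}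
    (hU : ContinuousOn U (Set.univ.pi X)) (i : Fin (n 0)) (t : ℕ) {p : Ω → E 0} (hp : Measurable p)
    (hpX : ∀ ω, p ω ∈ X 0) :
    Integrable (fun ω => U (Function.update (averages W x 0 i t ω) 0 (p ω))) P := by
  have averages_meas : Measurable (averages W x 0 i t) :=
    (h.averages_measurable t 0 i).mono (ℱ.le t) le_rfl
  exact integrable_comp_of_continuousOn (isCompact_univ_pi h.isCompact) hU
    (measurable_update'.comp (averages_meas.prodMk hp))
    fun ω k _ => update_mem_of_mem (h.averages_mem 0 i t ω) (hpX ω) k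

theorem integrable_apply_averages_sub [IsFiniteMeasure P]
    (h : IsStochasticMirrorDescent X ψ W α ℱ x ghat) {l : Fin 2} {g : Ω → StrongDual ℝ (E l)}
    (hg : Integrable g P) (i : Fin (n l)) (t : ℕ) (q : E l) :
    Integrable (fun ω => g ω (averages W x l i t ω l - q)) P := by
  obtain ⟨C, hC⟩ := h.exists_norm_averages_sub_le l q
  exact integrable_apply_of_norm_le hg
    ((h.integrable_averages l i t l).sub (integrable_const q)).1 (hC i t)

theorem integral_apply_averages_sub_eq [IsFiniteMeasure P]
    {g : ∀ l, Fin (n l) → ℕ → Ω → StrongDual ℝ (E l)} {ν : Fin 2 → ℝ}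
    (h : IsStochasticMirrorDescent X ψ W α ℱ x ghat)
    (hghat : UnbiasedBoundedVariance P ℱ ghat g ν) (l : Fin 2) (i : Fin (n l)) (t : ℕ) (q : E l) :
    ∫ ω, ghat l i t ω (averages W x l i t ω l - q) ∂P =
      ∫ ω, g l i t ω (averages W x l i t ω l - q) ∂P := by
  obtain ⟨C, hC⟩ := h.exists_norm_averages_sub_le l q
  exact integral_apply_eq_of_condExp_ae_eq (ℱ.le t) (hghat.integrable l i t)
    (hghat.unbiased l i t)
    (((measurable_pi_apply l).comp (h.averages_measurable t l i)).sub_const q).stronglyMeasurable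
    (hC i t)

theorem integral_norm_state_sub_networkMean_le [IsProbabilityMeasure P]
    (h : IsStochasticMirrorDescent X ψ W α ℱ x ghat) {l : Fin 2} {Γ θ Λ c : ℝ}
    (hW : IsGeometricMixing Γ θ (W l l)) (hΛ : ∀ i ω, ‖x l i 0 ω‖ ≤ Λ)
    (hghat : ∀ i t, Integrable (ghat l i t) P) (hc : ∀ i t, ∫ ω, ‖ghat l i t ω‖ ∂P ≤ c) {t : ℕ}
    (ht : 1 ≤ t) (i : Fin (n l)) :
    ∫ ω, ‖x l i t ω - networkMean (fun j => x l j t ω)‖ ∂P ≤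
      disagreementBound (n l) Γ θ Λ c α t := by
  obtain ⟨ω₀⟩ : Nonempty Ω := nonempty_of_isProbabilityMeasure P
  have hΛ0 : 0 ≤ Λ := (norm_nonneg _).trans (hΛ i ω₀)
  have hc0 : 0 ≤ c := (integral_nonneg fun _ => norm_nonneg _).trans (hc i 0)
  have step_le : ∀ i t, ∫ ω, ‖x l i (t + 1) ω - ∑ j, W l l t i j • x l j t ω‖ ∂P ≤ α t * c :=
    fun i t => calc
      _ ≤ ∫ ω, α t * ‖ghat l i t ω‖ ∂P :=
        integral_mono ((h.integrable_state l i (t + 1)).sub (h.integrable_averages l i t l)).norm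
          ((hghat i t).norm.const_mul _) (h.norm_state_sub_le l i t)
      _ ≤ α t * c := by
        rw [integral_const_mul]
        exact mul_le_mul_of_nonneg_left (hc i t) (h.stepSize_nonneg t)
  simpa only [Fintype.card_fin] using hW.integral_norm_sub_networkMean_le hΛ0 hc0
    h.stepSize_nonneg (h.integrable_state l) hΛ step_le ht i

theorem integral_norm_averages_sub_le [IsFiniteMeasure P]
    (h : IsStochasticMirrorDescent X ψ W α ℱ x ghat) {k : Fin 2} {t : ℕ} {c : Ω → E k}
    (hc : Integrable c P) {H : ℝ} (hH : ∀ j, ∫ ω, ‖x k j t ω - c ω‖ ∂P ≤ H) (l : Fin 2)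
    (i : Fin (n l)) : ∫ ω, ‖averages W x l i t ω k - c ω‖ ∂P ≤ H :=
  integral_norm_sum_smul_sub_le (h.weights_mem l k t i) (fun j => h.integrable_state k j t) hc hH

theorem integral_disagreement_le [IsFiniteMeasure P]
    (h : IsStochasticMirrorDescent X ψ W α ℱ x ghat) {t : ℕ} {c : ∀ k, Ω → E k}
    (hc : ∀ k, Integrable (c k) P) {H : Fin 2 → ℝ}
    (hH : ∀ k j, ∫ ω, ‖x k j t ω - c k ω‖ ∂P ≤ H k) (i j : Fin (n 0)) :
    Integrable (fun ω => ‖x 0 i t ω - c 0 ω‖ + ‖averages W x 0 j t ω 0 - c 0 ω‖ +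
      2 * (‖averages W x 0 i t ω 1 - c 1 ω‖ + ‖averages W x 0 j t ω 1 - c 1 ω‖)) P ∧
    ∫ ω, (‖x 0 i t ω - c 0 ω‖ + ‖averages W x 0 j t ω 0 - c 0 ω‖ +
      2 * (‖averages W x 0 i t ω 1 - c 1 ω‖ + ‖averages W x 0 j t ω 1 - c 1 ω‖)) ∂P ≤
      ∑ k, 4 * H k := by
  have state_norm : Integrable (fun ω => ‖x 0 i t ω - c 0 ω‖) P :=
    ((h.integrable_state 0 i t).sub (hc 0)).norm
  have averages_norm : ∀ j k, Integrable (fun ω => ‖averages W x 0 j t ω k - c k ω‖) P :=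
    fun j k => ((h.integrable_averages 0 j t k).sub (hc k)).norm
  have own : Integrable (fun ω => ‖x 0 i t ω - c 0 ω‖ + ‖averages W x 0 j t ω 0 - c 0 ω‖) P :=
    state_norm.add (averages_norm j 0)
  have other : Integrable (fun ω =>
      2 * (‖averages W x 0 i t ω 1 - c 1 ω‖ + ‖averages W x 0 j t ω 1 - c 1 ω‖)) P :=
    ((averages_norm i 1).add (averages_norm j 1)).const_mul 2
  refine ⟨own.add other, ?_⟩
  rw [integral_add own other, integral_add state_norm (averages_norm j 0), integral_const_mul,
    integral_add (averages_norm i 1) (averages_norm j 1), Fin.sum_univ_two]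
  have averages_le := fun k => h.integral_norm_averages_sub_le (hc k) (hH k) 0
  have H_nonneg : 0 ≤ H 0 := (integral_nonneg fun _ => norm_nonneg _).trans (hH 0 i)
  linarith [hH 0 i, averages_le 0 j, averages_le 1 i, averages_le 1 j]

theorem integral_gameCost_sub_le [IsProbabilityMeasure P]
    (h : IsStochasticMirrorDescent X ψ W α ℱ x ghat) {O : ∀ l, Set (E l)} (hXO : ∀ l, X l ⊆ O l)
    {f : ∀ l, Fin (n l) → (∀ k, E k) → ℝ} {L : ℝ} (hL : 0 ≤ L) (hf : LipschitzCosts O f L)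
    {g : ∀ l, Fin (n l) → ℕ → Ω → StrongDual ℝ (E l)} {ν : Fin 2 → ℝ}
    (hghat : UnbiasedBoundedVariance P ℱ ghat g ν)
    (hg : ∀ j t ω, g 0 j t ω ∈ partialSubdiff O 0 (f 0 j) (averages W x 0 j t ω)) {t : ℕ}
    {c : ∀ k, Ω → E k} (hc : ∀ k, Integrable (c k) P) {H : Fin 2 → ℝ}
    (hH : ∀ k j, ∫ ω, ‖x k j t ω - c k ω‖ ∂P ≤ H k) (i : Fin (n 0)) {q : E 0} (hq : q ∈ X 0) :
    ∫ ω, (gameCost f (Function.update (averages W x 0 i t ω) 0 (x 0 i t ω)) -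
        gameCost f (Function.update (averages W x 0 i t ω) 0 q)) ∂P ≤
      1 / (n 0 : ℝ) * ∑ j, ∫ ω, ghat 0 j t ω (averages W x 0 j t ω 0 - q) ∂P +
        ∑ k, 4 * L * H k := by
  have hU : ContinuousOn (gameCost f) (Set.univ.pi X) :=
    (hf.continuousOn_gameCost hL).mono (Set.pi_mono fun k _ => hXO k)
  have state_meas : Measurable (x 0 i t) := (h.state_measurable t 0 i).mono (ℱ.le t) le_rfl
  have linear := fun j => h.integrable_apply_averages_sub (hghat.integrable_mean 0 j t) j t q
  have error := fun j => h.integral_disagreement_le hc hH i j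
  have term := fun j => (linear j).add ((error j).1.const_mul L)
  have n_pos : (0 : ℝ) < n 0 := Nat.cast_pos.2 i.pos
  refine (integral_mono ((h.integrable_update_averages hU i t state_meas (h.state_mem 0 i t)).sub
    (h.integrable_update_averages hU i t measurable_const fun _ => hq))
    ((integrable_finsetSum _ fun j _ => term j).const_mul (1 / (n 0 : ℝ))) fun ω =>
    gameCost_sub_le hf hL (fun j k => hXO k (h.averages_mem 0 j t ω k)) (fun j => hg j t ω) i
      (hXO 0 (h.state_mem 0 i t ω)) (hXO 0 hq) fun k => c k ω).trans ?_
  rw [integral_const_mul, integral_finsetSum _ fun j _ => term j]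
  have term_le : ∀ j, _ ≤ ∫ ω, ghat 0 j t ω (averages W x 0 j t ω 0 - q) ∂P +
      L * ∑ k, 4 * H k := fun j => by
    refine (integral_add (linear j) ((error j).1.const_mul L)).trans_le ?_
    rw [integral_const_mul, h.integral_apply_averages_sub_eq hghat]
    exact add_le_add_right (mul_le_mul_of_nonneg_left (error j).2 hL) _
  refine (mul_le_mul_of_nonneg_left (Finset.sum_le_sum fun j _ => term_le j)
    (by positivity)).trans_eq ?_
  rw [Finset.sum_add_distrib, Finset.sum_const, Finset.card_univ, Fintype.card_fin, nsmul_eq_mul,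
    Fin.sum_univ_two, Fin.sum_univ_two]
  field_simp

theorem sum_integral_apply_averages_sub_le [IsProbabilityMeasure P]
    (h : IsStochasticMirrorDescent X ψ W α ℱ x ghat) (hα : Antitone α) {l : Fin 2}
    (hW : ∀ t, W l l t ∈ doublyStochastic ℝ (Fin (n l))) {M : ℝ}
    (hM : ∀ p ∈ X l, ∀ p' ∈ X l, bregman (X l) (ψ l) p p' ≤ M) {q : E l} (hq : q ∈ X l)
    (hconv : ConvexOn ℝ (X l) (bregman (X l) (ψ l) q))
    (hghat : ∀ j t, Integrable (ghat l j t) P)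
    (hsq : ∀ j t, Integrable (fun ω => ‖ghat l j t ω‖ ^ 2) P) {c : ℝ}
    (hc : ∀ j t, ∫ ω, ‖ghat l j t ω‖ ^ 2 ∂P ≤ c) {T : ℕ} (hT : 0 < α T) :
    ∑ t ∈ Finset.Icc 1 T, ∑ j, ∫ ω, ghat l j t ω (averages W x l j t ω l - q) ∂P ≤
      n l * (M / α T + ∑ t ∈ Finset.Icc 1 T, α t / 2 * c) := by
  have linear := fun j t => h.integrable_apply_averages_sub (hghat j t) j t q
  have square := fun j t => (hsq j t).const_mul (α t / 2)
  have squares : Integrable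
      (fun ω => ∑ t ∈ Finset.Icc 1 T, ∑ j, α t / 2 * ‖ghat l j t ω‖ ^ 2) P :=
    integrable_finsetSum _ fun t _ => integrable_finsetSum _ fun j _ => square j t
  calc ∑ t ∈ Finset.Icc 1 T, ∑ j, ∫ ω, ghat l j t ω (averages W x l j t ω l - q) ∂P
      = ∫ ω, ∑ t ∈ Finset.Icc 1 T, ∑ j, ghat l j t ω (averages W x l j t ω l - q) ∂P := by
        rw [integral_finsetSum _ fun t _ => integrable_finsetSum _ fun j _ => linear j t]
        exact Finset.sum_congr rfl fun t _ => (integral_finsetSum _ fun j _ => linear j t).symm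
    _ ≤ ∫ ω, (n l * M / α T + ∑ t ∈ Finset.Icc 1 T, ∑ j, α t / 2 * ‖ghat l j t ω‖ ^ 2) ∂P := by
        refine integral_mono
          (integrable_finsetSum _ fun t _ => integrable_finsetSum _ fun j _ => linear j t)
          ((integrable_const _).add squares) fun ω => ?_
        have := sum_apply_sub_le_of_mirrorDescent (h.isRegularizer l) hM hW hα
          (fun t j => h.state_mem l j t ω) (fun t j => h.update l j t ω) hq hconv hT
        rwa [Fintype.card_fin] at this
    _ = n l * M / α T + ∑ t ∈ Finset.Icc 1 T, ∑ j, α t / 2 * ∫ ω, ‖ghat l j t ω‖ ^ 2 ∂P := by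
        rw [integral_add (integrable_const _) squares, integral_const, probReal_univ, one_smul,
          integral_finsetSum _ fun t _ => integrable_finsetSum _ fun j _ => square j t]
        simp only [integral_finsetSum _ fun j _ => square j _, integral_const_mul]
    _ ≤ n l * M / α T + ∑ t ∈ Finset.Icc 1 T, ∑ _j : Fin (n l), α t / 2 * c := by
        gcongr with t _ j _
        · exact div_nonneg (h.stepSize_nonneg t) zero_le_two
        · exact hc j t
    _ = n l * (M / α T + ∑ t ∈ Finset.Icc 1 T, α t / 2 * c) := by
        simp only [Finset.sum_const, Finset.card_univ, Fintype.card_fin, nsmul_eq_mul,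
          ← Finset.mul_sum]
        ring

theorem pseudoRegret_le_of_disagreement_le [IsProbabilityMeasure P]
    (h : IsStochasticMirrorDescent X ψ W α ℱ x ghat) (hα : Antitone α) {O : ∀ l, Set (E l)}
    (hXO : ∀ l, X l ⊆ O l) {f : ∀ l, Fin (n l) → (∀ k, E k) → ℝ} {L : ℝ} (hL : 0 ≤ L)
    (hf : LipschitzCosts O f L) {g : ∀ l, Fin (n l) → ℕ → Ω → StrongDual ℝ (E l)} {ν : Fin 2 → ℝ}
    (hghat : UnbiasedBoundedVariance P ℱ ghat g ν)
    (hg : ∀ j t ω, g 0 j t ω ∈ partialSubdiff O 0 (f 0 j) (averages W x 0 j t ω))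
    (hsq : ∀ j t, Integrable (fun ω => ‖ghat 0 j t ω‖ ^ 2) P) {C : ℝ}
    (hC : ∀ j t, ∫ ω, ‖ghat 0 j t ω‖ ^ 2 ∂P ≤ C)
    (hW : ∀ t, W 0 0 t ∈ doublyStochastic ℝ (Fin (n 0)))
    (hconv : ∀ q ∈ X 0, ConvexOn ℝ (X 0) (bregman (X 0) (ψ 0) q)) {M : ℝ}
    (hM : ∀ p ∈ X 0, ∀ p' ∈ X 0, bregman (X 0) (ψ 0) p p' ≤ M) {c : ∀ k, ℕ → Ω → E k}
    (hc : ∀ k t, Integrable (c k t) P) {H : Fin 2 → ℕ → ℝ}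
    (hH : ∀ t, 1 ≤ t → ∀ k j, ∫ ω, ‖x k j t ω - c k t ω‖ ∂P ≤ H k t) (i : Fin (n 0)) {T : ℕ}
    (hT : 0 < α T) :
    pseudoRegret P X (gameCost f) (x 0 i) (averages W x 0 i) T ≤
      M / α T + ∑ t ∈ Finset.Icc 1 T, (α t / 2 * C + ∑ k, 4 * L * H k t) := by
  obtain ⟨ω₀⟩ : Nonempty Ω := nonempty_of_isProbabilityMeasure P
  have hU : ContinuousOn (gameCost f) (Set.univ.pi X) :=
    (hf.continuousOn_gameCost hL).mono (Set.pi_mono fun k _ => hXO k)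
  refine pseudoRegret_le_of_forall ⟨_, h.init_mem 0 i ω₀⟩
    (fun t => h.integrable_update_averages hU i t
      ((h.state_measurable t 0 i).mono (ℱ.le t) le_rfl) (h.state_mem 0 i t))
    (fun q hq t => h.integrable_update_averages hU i t measurable_const fun _ => hq) fun q hq => ?_
  have n_pos : (0 : ℝ) < n 0 := Nat.cast_pos.2 i.pos
  calc _ ≤ ∑ t ∈ Finset.Icc 1 T,
        (1 / (n 0 : ℝ) * ∑ j, ∫ ω, ghat 0 j t ω (averages W x 0 j t ω 0 - q) ∂P +
          ∑ k, 4 * L * H k t) :=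
        Finset.sum_le_sum fun t ht => h.integral_gameCost_sub_le hXO hL hf hghat hg (hc · t)
          (hH t (Finset.mem_Icc.1 ht).1) i hq
    _ = 1 / (n 0 : ℝ) * ∑ t ∈ Finset.Icc 1 T,
          ∑ j, ∫ ω, ghat 0 j t ω (averages W x 0 j t ω 0 - q) ∂P +
        ∑ t ∈ Finset.Icc 1 T, ∑ k, 4 * L * H k t := by
        rw [Finset.sum_add_distrib, Finset.mul_sum]
    _ ≤ 1 / (n 0 : ℝ) * (n 0 * (M / α T + ∑ t ∈ Finset.Icc 1 T, α t / 2 * C)) +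
        ∑ t ∈ Finset.Icc 1 T, ∑ k, 4 * L * H k t := by
        gcongr
        exact h.sum_integral_apply_averages_sub_le hα hW hM hq (hconv q hq)
          (hghat.integrable 0) hsq hC hT
    _ = M / α T + ∑ t ∈ Finset.Icc 1 T, (α t / 2 * C + ∑ k, 4 * L * H k t) := by
        rw [Finset.sum_add_distrib, ← mul_assoc, one_div_mul_cancel n_pos.ne', one_mul, add_assoc]

end IsStochasticMirrorDescent

section History

variable {E : Fin 2 → Type*} [∀ l, MeasurableSpace (E l)] {Ω : Type*} {n : Fin 2 → ℕ} {d : ℕ}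
  {x : ∀ l, Fin (n l) → ℕ → Ω → E l} {ξs : ∀ l, Fin (n l) → ℕ → Ω → Fin d → ℝ}

theorem history_mono : Monotone (history x ξs) := fun _s _t hst =>
  sup_le_sup le_rfl <| iSup_mono fun _ => iSup_mono fun _ => iSup_mono fun _ =>
    iSup_le fun hr => le_iSup_of_le (hr.trans_le hst) le_rfl

theorem history_le [mΩ : MeasurableSpace Ω] (hx : ∀ l i, Measurable (x l i 0))
    (hξs : ∀ l i t, Measurable (ξs l i t)) (t : ℕ) : history x ξs t ≤ mΩ :=
  sup_le (iSup_le fun l => iSup_le fun i => (hx l i).comap_le)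
    (iSup_le fun l => iSup_le fun i => iSup_le fun s => iSup_le fun _ => (hξs l i s).comap_le)

/-- The σ-algebras `history x ξs t` as a filtration. -/
def historyFiltration [mΩ : MeasurableSpace Ω] (hx : ∀ l i, Measurable (x l i 0))
    (hξs : ∀ l i t, Measurable (ξs l i t)) : Filtration ℕ mΩ :=
  ⟨history x ξs, history_mono, history_le hx hξs⟩

theorem measurable_history (t : ℕ) (l : Fin 2) (i : Fin (n l)) :
    Measurable[history x ξs t] (x l i 0) :=
  measurable_iff_comap_le.2 <| le_sup_of_le_left <| le_iSup_of_le l <| le_iSup_of_le i le_rfl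

end History

theorem IsCrossMixing.mem_stdSimplex {n : Fin 2 → ℕ} {G : ℕ → Digraph (Σ l, Fin (n l))}
    {W : ∀ l k : Fin 2, ℕ → Matrix (Fin (n l)) (Fin (n k)) ℝ} (h : IsCrossMixing G W)
    (hW : ∀ l t, W l l t ∈ doublyStochastic ℝ (Fin (n l))) (l k : Fin 2) (t : ℕ)
    (i : Fin (n l)) : W l k t i ∈ stdSimplex ℝ (Fin (n k)) := by
  obtain rfl | hlk := eq_or_ne l k
  · exact row_mem_stdSimplex (hW l t) i
  · exact ⟨h.nonneg l k hlk t i, h.row_sum l k hlk t i⟩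

namespace IsDSMD

variable {E : Fin 2 → Type*} [∀ l, NormedAddCommGroup (E l)] [∀ l, NormedSpace ℝ (E l)]
  [∀ l, MeasurableSpace (E l)] {Ω : Type*} {n : Fin 2 → ℕ} {d : ℕ} {X O : ∀ l, Set (E l)}
  {ψ : ∀ l, E l → ℝ} {Ψ : ∀ l, Fin (n l) → (∀ k, E k) → (Fin d → ℝ) → ℝ}
  {W : ∀ l k : Fin 2, ℕ → Matrix (Fin (n l)) (Fin (n k)) ℝ} {α : ℕ → ℝ}
  {ξs : ∀ l, Fin (n l) → ℕ → Ω → Fin d → ℝ} {x₀ : ∀ l, Fin (n l) → E l}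
  {x : ∀ l, Fin (n l) → ℕ → Ω → E l} {ghat : ∀ l, Fin (n l) → ℕ → Ω → StrongDual ℝ (E l)}

theorem measurable_init [MeasurableSpace Ω] (h : IsDSMD X O ψ Ψ W α ξs x₀ x ghat) (l : Fin 2)
    (i : Fin (n l)) : Measurable (x l i 0) := by
  rw [funext (h.init l i)]
  exact measurable_const

theorem isStochasticMirrorDescent [MeasurableSpace Ω]
    (h : IsDSMD X O ψ Ψ W α ξs x₀ x ghat) (hX : ∀ l, IsCompact (X l))
    (hψ : ∀ l, IsRegularizer (X l) (ψ l))
    (hW : ∀ l k t i, W l k t i ∈ stdSimplex ℝ (Fin (n k))) (hα : ∀ t, 0 ≤ α t)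
    (hξs : ∀ l i t, Measurable (ξs l i t)) :
    IsStochasticMirrorDescent X ψ W α (historyFiltration h.measurable_init hξs) x ghat where
  isCompact := hX
  isRegularizer := hψ
  weights_mem := hW
  stepSize_nonneg := hα
  init_mem l i ω := h.init l i ω ▸ h.init_mem l i
  init_measurable := measurable_history 0
  gradient_measurable := h.sample_measurable
  update := h.update

theorem norm_init_le (h : IsDSMD X O ψ Ψ W α ξs x₀ x ghat) (l : Fin 2) (i : Fin (n l)) (ω : Ω) :
    ‖x l i 0 ω‖ ≤ ⨆ i, ‖x₀ l i‖ := by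
  rw [h.init]
  exact le_ciSup (f := fun i => ‖x₀ l i‖) (Set.finite_range _).bddAbove i

end IsDSMD

theorem four_mul_disagreementBound_add (N : ℕ) (L Γ θ Λ ν : ℝ) (α : ℕ → ℝ) (t : ℕ) :
    4 * L * disagreementBound N Γ θ Λ (L + ν) α t + (L + ν) ^ 2 * α (t - 1) =
      (L + ν) * (9 * L + ν) * α (t - 1) +
        4 * L * (N * Γ * (L + ν) * ∑ s ∈ Finset.Icc 1 (t - 1), θ ^ (t - 1 - s) * α (s - 1)) +
        4 * L * (N * Γ * θ ^ (t - 1) * Λ) := by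
  unfold disagreementBound
  ring

theorem theorem2_general {E : Fin 2 → Type*} [∀ l, NormedAddCommGroup (E l)]
    [∀ l, NormedSpace ℝ (E l)] [∀ l, SecondCountableTopology (E l)] [∀ l, MeasurableSpace (E l)]
    [∀ l, BorelSpace (E l)] {Ω : Type*} {mΩ : MeasurableSpace Ω} {P : Measure Ω}
    [IsProbabilityMeasure P] {n : Fin 2 → ℕ} {X O : ∀ l, Set (E l)} {ψ : ∀ l, E l → ℝ}
    {W : ∀ l k : Fin 2, ℕ → Matrix (Fin (n l)) (Fin (n k)) ℝ} {α : ℕ → ℝ} {ℱ : Filtration ℕ mΩ}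
    {x : ∀ l, Fin (n l) → ℕ → Ω → E l} {ghat g : ∀ l, Fin (n l) → ℕ → Ω → StrongDual ℝ (E l)}
    (hrun : IsStochasticMirrorDescent X ψ W α ℱ x ghat) (hα : Antitone α)
    (hO : ∀ l, IsOpen (O l)) (hXO : ∀ l, X l ⊆ O l) {f : ∀ l, Fin (n l) → (∀ k, E k) → ℝ}
    (hg : ∀ l i t ω, g l i t ω ∈ partialSubdiff O l (f l i) (averages W x l i t ω))
    {L : ℝ} (hL : 0 ≤ L) (hf : LipschitzCosts O f L) {ν : Fin 2 → ℝ} (hν : ∀ l, 0 ≤ ν l)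
    (hghat : UnbiasedBoundedVariance P ℱ ghat g ν) {Γ θ Λ : Fin 2 → ℝ}
    (hW : ∀ l, IsGeometricMixing (Γ l) (θ l) (W l l)) (hΛ : ∀ l i ω, ‖x l i 0 ω‖ ≤ Λ l)
    (hconv : ∀ q ∈ X 0, ConvexOn ℝ (X 0) (bregman (X 0) (ψ 0) q)) {M : ℝ}
    (hM : ∀ p ∈ X 0, ∀ p' ∈ X 0, bregman (X 0) (ψ 0) p p' ≤ M) (i : Fin (n 0)) {T : ℕ}
    (hT : 0 < α T) :
    pseudoRegret P X (gameCost f) (x 0 i) (averages W x 0 i) T ≤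
      (∑ t ∈ Finset.Icc 1 T, ∑ l, (L + ν l) * (9 * L + ν l) * α (t - 1))
      + 4 * L * (∑ t ∈ Finset.Icc 1 T, ∑ l, n l * Γ l * (L + ν l) *
          ∑ s ∈ Finset.Icc 1 (t - 1), θ l ^ (t - 1 - s) * α (s - 1))
      + 4 * L * (∑ t ∈ Finset.Icc 1 T, ∑ l, n l * Γ l * θ l ^ (t - 1) * Λ l)
      + M / α T := by
  have norm_g_le : ∀ l i t ω, ‖g l i t ω‖ ≤ L := fun l i t ω => hf.norm_le_of_mem_partialSubdiff
    hO hL l i (fun k => hXO k (hrun.averages_mem l i t ω k)) (hg l i t ω)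
  have regret_le := hrun.pseudoRegret_le_of_disagreement_le hα hXO hL hf hghat (hg 0)
    (hghat.integrable_norm_sq norm_g_le 0) (hghat.integral_norm_sq_le norm_g_le hν 0)
    (hW 0).mem_doublyStochastic hconv hM hrun.integrable_networkMean
    (fun t ht k => hrun.integral_norm_state_sub_networkMean_le (hW k) (hΛ k) (hghat.integrable k)
      (hghat.integral_norm_le hL norm_g_le hν k) ht) i hT
  have step_le : ∀ t, α t / 2 * (L + ν 0) ^ 2 ≤ ∑ l, (L + ν l) ^ 2 * α (t - 1) := fun t => by
    have half_le : α t / 2 ≤ α (t - 1) :=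
      (half_le_self (hrun.stepSize_nonneg t)).trans (hα (Nat.sub_le t 1))
    calc α t / 2 * (L + ν 0) ^ 2 ≤ (L + ν 0) ^ 2 * α (t - 1) := by
          rw [mul_comm]
          exact mul_le_mul_of_nonneg_left half_le (sq_nonneg _)
      _ ≤ ∑ l, (L + ν l) ^ 2 * α (t - 1) :=
          Finset.single_le_sum (f := fun l => (L + ν l) ^ 2 * α (t - 1))
            (fun l _ => mul_nonneg (sq_nonneg _) (hrun.stepSize_nonneg _)) (Finset.mem_univ 0)
  calc _ ≤ M / α T + ∑ t ∈ Finset.Icc 1 T, ∑ l, (4 * L *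
        disagreementBound (n l) (Γ l) (θ l) (Λ l) (L + ν l) α t + (L + ν l) ^ 2 * α (t - 1)) := by
        refine regret_le.trans ?_
        gcongr with t
        rw [Finset.sum_add_distrib, add_comm]
        gcongr
        exact step_le t
    _ = _ := by
        simp only [four_mul_disagreementBound_add, Finset.sum_add_distrib, ← Finset.mul_sum]
        exact add_comm _ _

theorem theorem2 {E : Fin 2 → Type*} [∀ l, NormedAddCommGroup (E l)] [∀ l, NormedSpace ℝ (E l)]
    [∀ l, FiniteDimensional ℝ (E l)] [∀ l, MeasurableSpace (E l)] [∀ l, BorelSpace (E l)]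
    {Ω : Type*} [MeasurableSpace Ω] (P : Measure Ω) [IsProbabilityMeasure P]
    {d : ℕ} (ξ : Ω → Fin d → ℝ) (n : Fin 2 → ℕ) (hn : ∀ l, 1 ≤ n l)
    (X O : ∀ l, Set (E l)) (ψ : ∀ l, E l → ℝ) (hψ : ∀ l, IsRegularizer (X l) (ψ l))
    (Ψ : ∀ l, Fin (n l) → (∀ k, E k) → (Fin d → ℝ) → ℝ)
    (hΨ : ∀ l i, ∀ z : ∀ k, E k, (∀ k, z k ∈ O k) → Integrable (fun ω => Ψ l i z (ξ ω)) P)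
    (f : ∀ l, Fin (n l) → (∀ k, E k) → ℝ) (hf : ∀ l i, f l i = expectedCost P ξ (Ψ l i))
    (hgame : IsTwoNetworkGame X O f)
    (η : ℝ) (hη0 : 0 < η) (hη1 : η < 1) (B : Fin 2 → ℕ) (hB : ∀ l, 1 ≤ B l)
    (G : ∀ l, ℕ → Digraph (Fin (n l))) (G12 : ℕ → Digraph (Σ l, Fin (n l)))
    (W : ∀ l k : Fin 2, ℕ → Matrix (Fin (n l)) (Fin (n k)) ℝ)
    (hW : ∀ l, IsNetworkMixing η (B l) (G l) (W l l)) (hW12 : IsCrossMixing G12 W)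
    (α : ℕ → ℝ) (hα0 : ∀ t, 0 ≤ α t) (hα : Antitone α)
    (ξs : ∀ l, Fin (n l) → ℕ → Ω → Fin d → ℝ) (hξs : IsIIDSample P ξ ξs)
    (x₀ : ∀ l, Fin (n l) → E l) (x : ∀ l, Fin (n l) → ℕ → Ω → E l)
    (ghat g : ∀ l, Fin (n l) → ℕ → Ω → StrongDual ℝ (E l))
    (hrun : IsDSMD X O ψ Ψ W α ξs x₀ x ghat)
    (hg : ∀ l i t ω, g l i t ω ∈ partialSubdiff O l (f l i) (averages W x l i t ω))
    (L : ℝ) (hL : 0 < L) (ν : Fin 2 → ℝ) (hν : ∀ l, 0 < ν l)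
    (hA1 : LipschitzCosts O f L)
    (hA2 : UnbiasedBoundedVariance P (history x ξs) ghat g ν)
    (hA3 : ∀ l, BregmanConvexReciprocal (X l) (ψ l))
    (R₁ : ℝ)
    (hR₁ : IsGreatest {r | ∃ y ∈ X 0, ∃ y' ∈ X 0, r = bregman (X 0) (ψ 0) y y'} (R₁ ^ 2))
    (Γ θ Λ : Fin 2 → ℝ) (hΓ : ∀ l, Γ l = mixGamma η (n l))
    (hθ : ∀ l, θ l = mixTheta η (n l) (B l)) (hΛ : ∀ l, Λ l = ⨆ i, ‖x₀ l i‖)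
    (i : Fin (n 0)) (T : ℕ) (hT : 0 < α T) :
    pseudoRegret P X (gameCost f) (x 0 i) (averages W x 0 i) T ≤
      (∑ t ∈ Finset.Icc 1 T, ∑ l, (L + ν l) * (9 * L + ν l) * α (t - 1))
      + 4 * L * (∑ t ∈ Finset.Icc 1 T, ∑ l, n l * Γ l * (L + ν l) *
          ∑ s ∈ Finset.Icc 1 (t - 1), θ l ^ (t - 1 - s) * α (s - 1))
      + 4 * L * (∑ t ∈ Finset.Icc 1 T, ∑ l, n l * Γ l * θ l ^ (t - 1) * Λ l)
      + R₁ ^ 2 / α T := by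
  have hmix := fun l => (hW l).isGeometricMixing hη0 hη1 (hB l)
  exact theorem2_general
    (hrun.isStochasticMirrorDescent hgame.compact hψ
      (hW12.mem_stdSimplex fun l => (hmix l).mem_doublyStochastic) hα0 hξs.measurable)
    hα hgame.isOpen hgame.subset hg hL.le hA1 (fun l => (hν l).le) hA2
    (fun l => hΓ l ▸ hθ l ▸ hmix l) (fun l i ω => hΛ l ▸ hrun.norm_init_le l i ω)
    (hA3 0).convexOn (fun p hp p' hp' => hR₁.2 ⟨p, hp, p', hp', rfl⟩) i hT
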